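/- Let $p$ be a prime and let $F$ be a field which contains a primitive $p$-th root of unity if $p$ is odd, and a primitive fourth root of unity if $p=2$. Suppose that there is $k\in\mathbb N$ such that $F$ contains a primitive $p^k$-th root of unity but no primitive $p^{k+1}$-th root of unity. Fix a separable closure $F_{sep}$ of $F$. For a field $K$ with $F\subseteq K\subseteq F_{sep}$ let $K(p)\subseteq F_{sep}$ be the compositum of all finite Galois extensions of $K$ of $p$-power degree inside $F_{sep}$, and let $G_K(p)=\mathrm{Gal}(K(p)/K)$, with the Krull topology, be the maximal pro-$p$ quotient of the absolute Galois group of $K$. Let $CR(F)\subseteq F_{sep}$ be the compositum of the fields $F(\sqrt[p^m]{a},\zeta_{p^m})$, where $a\in F^\times$ and $m\ge 1$. Let $\varphi\colon G_F(p)\to\mathbb Z_p^\times$ be the $p$-cyclotomic character, determined by $\sigma(\xi)=\xi^{\varphi(\sigma)}$ for all roots of unity $\xi$ of $p$-power order. Then the natural homomorphism $G_{CR(F)}(p)\to G_F(p)$, given by restricting automorphisms of $CR(F)(p)$ to $F(p)$, is injective and a homeomorphism onto a closed subgroup, and its image is the closed subgroup of $G_F(p)$ generated by all elements $$[\sigma,\tau]\,\tau^{1-\varphi(\sigma)},\qquad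 \sigma\in G_F(p),\ \tau\in\ker\varphi,$$ where $[\sigma,\tau]=\sigma\tau\sigma^{-1}\tau^{-1}$ and, for $z\in\mathbb Z_p$, $\tau^{z}$ is the limit of $\tau^{n}$ as the integer $n$ tends $p$-adically to $z$. -/

import Mathlib

open Filter Topology

/-- The maximal `p`-extension `K(p)` of a field `K` inside an overfield `Ω` (a separable closure
of `K` in all uses): the compositum of all finite Galois extensions of `p`-power degree. -/
def maximalPExtension (p : ℕ) (K Ω : Type*) [Field K] [Field Ω] [Algebra K Ω] :
    IntermediateField K Ω :=
  ⨆ E : {E : IntermediateField K Ω //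
    FiniteDimensional K E ∧ IsGalois K E ∧ ∃ n : ℕ, Module.finrank K E = p ^ n}, E.1

instance maximalPExtension.normal (p : ℕ) (K Ω : Type*) [Field K] [Field Ω] [Algebra K Ω] :
    Normal K (maximalPExtension p K Ω) := by
  have h : ∀ E : {E : IntermediateField K Ω //
      FiniteDimensional K E ∧ IsGalois K E ∧ ∃ n : ℕ, Module.finrank K E = p ^ n},
      Normal K E.1 := fun E => by
    have := E.2.2.1
    infer_instance
  exact IntermediateField.normal_iSup K Ω _

/-- The group `G_K(p) = Gal(K(p)/K)`, i.e. the maximal pro-`p` quotient of the absolute Galois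
group `Gal(Ω/K)` when `Ω` is a separable closure of `K`; it carries the Krull topology. -/
abbrev proPGaloisGroup (p : ℕ) (K Ω : Type*) [Field K] [Field Ω] [Algebra K Ω] : Type _ :=
  Gal(maximalPExtension p K Ω/K)

/-- A finite Galois `p`-extension `E/K` gives, after base change to `L`, a finite Galois
`p`-extension of `L`; hence `K(p) ⊆ L(p)`. -/
theorem mem_maximalPExtension_of_mem {p : ℕ} [Fact p.Prime] {K Ω : Type*} [Field K] [Field Ω]
    [Algebra K Ω] (L : IntermediateField K Ω) {x : Ω} (hx : x ∈ maximalPExtension p K Ω) :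
    x ∈ maximalPExtension p L Ω := by
  suffices h : maximalPExtension p K Ω ≤ (maximalPExtension p L Ω).restrictScalars K from h hx
  refine iSup_le ?_
  rintro ⟨E, hfin, hgal, n, hn⟩
  obtain ⟨T, hT, hTs⟩ := IsGalois.is_separable_splitting_field K E
  have hsplit : (T.map (algebraMap K Ω)).Splits := by
    rw [IsScalarTower.algebraMap_eq K E Ω, ← Polynomial.map_map]
    exact hTs.splits.map _
  have hE : E = IntermediateField.adjoin K (T.rootSet Ω) := by
    have h := (isSplittingField_iff_intermediateField.mp hTs).2
    have h2 := congrArg IntermediateField.lift h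
    rw [IntermediateField.lift_adjoin, IntermediateField.lift_top,
      ← IntermediateField.coe_val, hTs.splits.image_rootSet] at h2
    exact h2.symm
  let M : IntermediateField L Ω := IntermediateField.adjoin L (T.rootSet Ω)
  have hroot : (T.map (algebraMap K L)).rootSet Ω = T.rootSet Ω := by
    simp [Set.ext_iff, Polynomial.mem_rootSet']
  have hM : (T.map (algebraMap K L)).IsSplittingField L M := by
    have := IntermediateField.adjoin_rootSet_isSplittingField (K := L) (L := Ω)
      (p := T.map (algebraMap K L))
      (by rw [Polynomial.map_map, ← IsScalarTower.algebraMap_eq]; exact hsplit)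
    rwa [hroot] at this
  have hMgal : IsGalois L M :=
    IsGalois.of_separable_splitting_field (p := T.map (algebraMap K L)) hT.map
  have hMfin : FiniteDimensional L M :=
    Polynomial.IsSplittingField.finiteDimensional M (T.map (algebraMap K L))
  have hEM : E ≤ M.restrictScalars K := by
    rw [hE, IntermediateField.adjoin_le_iff]
    exact IntermediateField.subset_adjoin L _
  let _ : Algebra E M := (IntermediateField.inclusion hEM).toRingHom.toAlgebra
  have : IsScalarTower K E M := IsScalarTower.of_algebraMap_eq fun _ => rfl
  let f : Gal(M/L) →* Gal(E/K) := IntermediateField.restrictRestrictAlgEquivMapHom K E L M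
  have hf : ∀ (g : Gal(M/L)) (y : E), algebraMap E M (f g y) = g (algebraMap E M y) :=
    fun g y => AlgEquiv.restrictNormal_commutes _ E y
  have hinj : Function.Injective f := by
    refine (injective_iff_map_eq_one f).mpr fun g hg => ?_
    have hle : M ≤ IntermediateField.lift
        (IntermediateField.fixedField (Subgroup.zpowers g)) := by
      refine IntermediateField.adjoin_le_iff.mpr fun y hy => ?_
      have hyE : y ∈ E := hE ▸ IntermediateField.subset_adjoin K _ hy
      refine ⟨⟨y, hEM hyE⟩, ?_, rfl⟩
      have hgy : g ⟨y, hEM hyE⟩ = ⟨y, hEM hyE⟩ := by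
        have := hf g ⟨y, hyE⟩
        rw [hg] at this
        exact this.symm
      intro z
      have hz : z.1 ∈ MulAction.stabilizer Gal(M/L) (⟨y, hEM hyE⟩ : M) :=
        Subgroup.zpowers_le.mpr (MulAction.mem_stabilizer_iff.mpr hgy) z.2
      exact MulAction.mem_stabilizer_iff.mp hz
    ext ⟨y, hy⟩
    obtain ⟨y', hy', hyy⟩ := hle hy
    have h1 := hy' ⟨g, Subgroup.mem_zpowers g⟩
    have h2 : y' = ⟨y, hy⟩ := Subtype.ext hyy
    rw [h2] at h1
    exact congrArg Subtype.val h1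
  have hcard : ∃ m : ℕ, Module.finrank L M = p ^ m := by
    have hp : IsPGroup p Gal(E/K) := IsPGroup.of_card (n := n)
      (by rw [IsGalois.card_aut_eq_finrank, hn])
    rw [← IsGalois.card_aut_eq_finrank]
    exact IsPGroup.iff_card.mp (hp.of_injective f hinj)
  refine le_trans hEM ?_
  intro y hy
  exact (le_iSup (fun E : {E : IntermediateField L Ω //
    FiniteDimensional L E ∧ IsGalois L E ∧ ∃ n : ℕ, Module.finrank L E = p ^ n} => E.1)
    ⟨M, hMfin, hMgal, hcard⟩) hy

/-- The inclusion `K(p) → L(p)` for `K ⊆ L ⊆ Ω`. -/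
def maximalPExtensionInclusion (p : ℕ) [Fact p.Prime] {K Ω : Type*} [Field K] [Field Ω]
    [Algebra K Ω] (L : IntermediateField K Ω) :
    maximalPExtension p K Ω →+* maximalPExtension p L Ω :=
  (algebraMap (maximalPExtension p K Ω) Ω).codRestrict (maximalPExtension p L Ω)
    fun x => mem_maximalPExtension_of_mem L x.2

theorem restrictRestrictAlgEquivMapHom_commutes (F K L E : Type*) [Field F] [Field K] [Field L]
    [Field E] [Algebra F K] [Algebra F L] [Algebra F E] [Algebra K E] [Algebra L E]
    [IsScalarTower F K E] [IsScalarTower F L E] [Normal F K] (g : Gal(E/L)) (x : K) :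
    algebraMap K E (IntermediateField.restrictRestrictAlgEquivMapHom F K L E g x) =
      g (algebraMap K E x) :=
  AlgEquiv.restrictNormal_commutes (MulSemiringAction.toAlgAut Gal(E/L) F E g) K x

/-- The natural homomorphism `G_L(p) → G_K(p)` for `K ⊆ L ⊆ Ω`: an automorphism of `L(p)` over `L`
is restricted to the subfield `K(p)`. -/
noncomputable def proPRestrict (p : ℕ) [Fact p.Prime] {K Ω : Type*} [Field K] [Field Ω]
    [Algebra K Ω] (L : IntermediateField K Ω) : proPGaloisGroup p L Ω →* proPGaloisGroup p K Ω :=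
  letI := (maximalPExtensionInclusion p L).toAlgebra
  haveI : IsScalarTower K (maximalPExtension p K Ω) (maximalPExtension p L Ω) :=
    IsScalarTower.of_algebraMap_eq' rfl
  IntermediateField.restrictRestrictAlgEquivMapHom K (maximalPExtension p K Ω) L
    (maximalPExtension p L Ω)

theorem proPRestrict_apply (p : ℕ) [Fact p.Prime] {K Ω : Type*} [Field K] [Field Ω]
    [Algebra K Ω] (L : IntermediateField K Ω) (g : proPGaloisGroup p L Ω)
    (x : maximalPExtension p K Ω) :
    maximalPExtensionInclusion p L (proPRestrict p L g x) =
      g (maximalPExtensionInclusion p L x) := by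
  let _ := (maximalPExtensionInclusion p L).toAlgebra
  have : IsScalarTower K (maximalPExtension p K Ω) (maximalPExtension p L Ω) :=
    IsScalarTower.of_algebraMap_eq' rfl
  exact restrictRestrictAlgEquivMapHom_commutes K (maximalPExtension p K Ω) L
    (maximalPExtension p L Ω) g x

/-- The `p`-cyclotomic radical extension `CR(F)` inside `Ω`: the compositum of all fields
`F(a^(1/p^m), ζ_(p^m))` with `a ∈ F^×` and `m ≥ 0`. -/
def cyclotomicRadicalExtension (p : ℕ) (F Ω : Type*) [Field F] [Field Ω] [Algebra F Ω] :
    IntermediateField F Ω :=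
  ⨆ (m : ℕ) (a : Fˣ), IntermediateField.adjoin F
    ({x : Ω | x ^ p ^ m = algebraMap F Ω a} ∪ {z : Ω | z ^ p ^ m = 1})

/-- The `p`-cyclotomic character `φ` of `F` on `G_F(p)`: `σ(ξ) = ξ ^ φ(σ)` for all roots of unity
`ξ` of `p`-power order (which lie in `F(p)` when `F` contains a primitive `p`-th root of unity). -/
noncomputable def proPCyclotomicCharacter (p : ℕ) [Fact p.Prime] (F Ω : Type*) [Field F]
    [Field Ω] [Algebra F Ω] : proPGaloisGroup p F Ω →* ℤ_[p]ˣ :=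
  (cyclotomicCharacter (maximalPExtension p F Ω) p).comp
    (MulSemiringAction.toRingAut (proPGaloisGroup p F Ω) (maximalPExtension p F Ω))

/-- The `p`-adic power `g ^ z` of an element of a pro-`p` group: the limit of the integral powers
`g ^ n` as `n → z` in the `p`-adic topology. -/
noncomputable def padicPow {p : ℕ} [Fact p.Prime] {G : Type*} [Group G] [TopologicalSpace G]
    (g : G) (z : ℤ_[p]) : G :=
  limUnder (comap (Int.cast : ℤ → ℤ_[p]) (𝓝 z)) fun n : ℤ => g ^ n

/-- Every element of `K(p)` is fixed by all sufficiently high `p`-power powers in `G_K(p)`. -/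
theorem exists_pow_fix (p : ℕ) [Fact p.Prime] (K Ω : Type*) [Field K] [Field Ω]
    [Algebra K Ω] (x : maximalPExtension p K Ω) :
    ∃ n : ℕ, ∀ g : proPGaloisGroup p K Ω, ∀ m, n ≤ m → (g ^ p ^ m) x = x := by
  let M : IntermediateField K (maximalPExtension p K Ω) :=
    { carrier := {y | ∃ n : ℕ, ∀ g : proPGaloisGroup p K Ω, ∀ m, n ≤ m → (g ^ p ^ m) y = y}
      mul_mem' := by
        rintro a b ⟨n, hn⟩ ⟨n', hn'⟩
        refine ⟨max n n', fun g m hm => ?_⟩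
        rw [map_mul, hn g m (le_trans (le_max_left _ _) hm),
          hn' g m (le_trans (le_max_right _ _) hm)]
      add_mem' := by
        rintro a b ⟨n, hn⟩ ⟨n', hn'⟩
        refine ⟨max n n', fun g m hm => ?_⟩
        rw [map_add, hn g m (le_trans (le_max_left _ _) hm),
          hn' g m (le_trans (le_max_right _ _) hm)]
      algebraMap_mem' := fun r => ⟨0, fun g m _ => AlgEquiv.commutes _ r⟩
      inv_mem' := by
        rintro a ⟨n, hn⟩
        exact ⟨n, fun g m hm => by rw [map_inv₀, hn g m hm]⟩ }
  have hle : maximalPExtension p K Ω ≤ IntermediateField.lift M := by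
    refine iSup_le ?_
    rintro ⟨E, hfin, hgal, n, hn⟩ y hy
    have hE : E ≤ maximalPExtension p K Ω :=
      le_iSup (fun E : {E : IntermediateField K Ω //
        FiniteDimensional K E ∧ IsGalois K E ∧ ∃ n : ℕ, Module.finrank K E = p ^ n} => E.1)
        ⟨E, hfin, hgal, n, hn⟩
    refine ⟨⟨y, hE hy⟩, ⟨n, fun g m hm => ?_⟩, rfl⟩
    let _ : Algebra E (maximalPExtension p K Ω) :=
      (IntermediateField.inclusion hE).toRingHom.toAlgebra
    have : IsScalarTower K E (maximalPExtension p K Ω) :=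
      IsScalarTower.of_algebraMap_eq fun _ => rfl
    have hone : AlgEquiv.restrictNormalHom E (g ^ p ^ m) = 1 := by
      obtain ⟨j, rfl⟩ := Nat.exists_eq_add_of_le hm
      rw [pow_add, pow_mul, map_pow, map_pow, ← hn, ← IsGalois.card_aut_eq_finrank,
        pow_card_eq_one', one_pow]
    have h := AlgEquiv.restrictNormal_commutes (g ^ p ^ m) E ⟨y, hy⟩
    change algebraMap E _ (AlgEquiv.restrictNormalHom E (g ^ p ^ m) ⟨y, hy⟩) = _ at h
    rw [hone] at h
    exact h.symm
  obtain ⟨y, hy, hyx⟩ := hle x.2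
  have : y = x := Subtype.ext hyx
  exact this ▸ hy

/-- The limits defining `p`-adic powers exist in `G_K(p)`. -/
theorem tendsto_padicPow (p : ℕ) [Fact p.Prime] (K Ω : Type*) [Field K] [Field Ω]
    [Algebra K Ω] [Algebra.IsSeparable K Ω] (g : proPGaloisGroup p K Ω) (z : ℤ_[p]) :
    Tendsto (fun n : ℤ => g ^ n) (comap (Int.cast : ℤ → ℤ_[p]) (𝓝 z)) (𝓝 (padicPow g z)) := by
  have : IsGalois K (maximalPExtension p K Ω) := ⟨⟩
  have hne : (comap (Int.cast : ℤ → ℤ_[p]) (𝓝 z)).NeBot :=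
    comap_neBot_iff.mpr fun t ht => by
      obtain ⟨_, hy, n, rfl⟩ := mem_closure_iff_nhds.mp (PadicInt.denseRange_intCast z) t ht
      exact ⟨n, hy⟩
  have hfix : ∀ E : IntermediateField K (maximalPExtension p K Ω), FiniteDimensional K E →
      ∃ n : ℕ, g ^ p ^ n ∈ E.fixingSubgroup := by
    intro E hE
    obtain ⟨s, hs⟩ :=
      IntermediateField.fg_of_fg_toSubalgebra E
        (Subalgebra.fg_of_fg_toSubmodule (Module.Finite.iff_fg.mp hE))
    choose N hN using exists_pow_fix p K Ω
    refine ⟨s.sup N, ?_⟩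
    have hle : E ≤ IntermediateField.fixedField (Subgroup.zpowers (g ^ p ^ (s.sup N))) := by
      rw [← hs]
      refine IntermediateField.adjoin_le_iff.mpr fun y hy z => ?_
      have hz : z.1 ∈ MulAction.stabilizer (proPGaloisGroup p K Ω) y :=
        Subgroup.zpowers_le.mpr (MulAction.mem_stabilizer_iff.mpr
          (hN y g _ (Finset.le_sup hy))) z.2
      exact MulAction.mem_stabilizer_iff.mp hz
    rw [IntermediateField.mem_fixingSubgroup_iff]
    intro y hy
    exact hle hy ⟨_, Subgroup.mem_zpowers _⟩
  refine tendsto_nhds_limUnder ?_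
  obtain ⟨u, -, hu⟩ := isCompact_univ (X := proPGaloisGroup p K Ω)
    (f := map (fun n : ℤ => g ^ n) (comap (Int.cast : ℤ → ℤ_[p]) (𝓝 z))) (by simp)
  refine ⟨u, fun s hs => ?_⟩
  have hs1 : (fun x => u * x) ⁻¹' s ∈ 𝓝 (1 : proPGaloisGroup p K Ω) :=
    (continuous_const_mul u).continuousAt.preimage_mem_nhds (by simpa using hs)
  obtain ⟨E, hE, hEs⟩ := (krullTopology_mem_nhds_one_iff K _ _).mp hs1
  obtain ⟨n, hn⟩ := hfix E hE
  let B : Set ℤ := Int.cast ⁻¹' (Metric.ball z ((p : ℝ) ^ (-(n : ℤ) + 1)))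
  have hp0 : (0 : ℝ) < p := by exact_mod_cast (Fact.out : p.Prime).pos
  have hB : B ∈ comap (Int.cast : ℤ → ℤ_[p]) (𝓝 z) :=
    preimage_mem_comap (Metric.ball_mem_nhds z (zpow_pos hp0 _))
  have hdiff : ∀ a ∈ B, ∀ b ∈ B, (p : ℤ) ^ n ∣ a - b := by
    intro a ha b hb
    rw [← PadicInt.norm_int_le_pow_iff_dvd, PadicInt.norm_le_pow_iff_norm_lt_pow_add_one]
    have h : ((a - b : ℤ) : ℤ_[p]) = (a - z) + (z - b) := by push_cast; ring
    rw [h]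
    refine lt_of_le_of_lt (PadicInt.nonarchimedean _ _) (max_lt ?_ ?_)
    · exact mem_ball_iff_norm.mp ha
    · rw [norm_sub_rev]
      exact mem_ball_iff_norm.mp hb
  have hopen : (fun x => u * x) '' (E.fixingSubgroup : Set (proPGaloisGroup p K Ω)) ∈ 𝓝 u :=
    (isOpenMap_mul_left u _ E.fixingSubgroup_isOpen).mem_nhds
      ⟨1, E.fixingSubgroup.one_mem, mul_one u⟩
  obtain ⟨_, ⟨w, hw, hwa⟩, ⟨a, ha, rfl⟩⟩ :=
    (clusterPt_iff_nonempty.mp hu) hopen (image_mem_map hB)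
  refine mem_map.mpr (mem_of_superset hB fun b hb => ?_)
  obtain ⟨c, hc⟩ := hdiff b hb a ha
  have hb' : g ^ b = u * (w * (g ^ p ^ n) ^ c) := by
    have : b = a + (p ^ n : ℕ) * c := by push_cast; linarith
    rw [this, zpow_add, zpow_mul, zpow_natCast, ← mul_assoc]
    exact congrArg (· * _) hwa.symm
  change g ^ b ∈ s
  rw [hb']
  exact hEs (E.fixingSubgroup.mul_mem hw (E.fixingSubgroup.zpow_mem hn c))

/-! Write M = F(p) and G = Gal(M/F). Since F contains a primitive p-th root of unity, M is closed
under extraction of p-th roots, so M contains CR(F) and all roots of unity of p-power order.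
Moreover F(p) is p-closed (`maximalPExtension_subset_of_le`), so CR(F)(p) = F(p). Restriction
therefore identifies G_{CR(F)}(p) with the subgroup N of G fixing CR(F) (`range_proPRestrict`). It
remains to compare N with the closed subgroup H generated by the relations.

H ≤ N is Kummer theory (`commutator_mul_zpow_apply`): if τ ∈ ker φ multiplies a p^m-th root y of an
element of F by η, then στσ⁻¹ multiplies y by σ(η) = η^φ(σ), so the relation multiplies y by η^(φ(σ)
- 1 + 1 - φ(σ)) = 1.

For N ≤ H, H is closed and normal, so it is enough that τ ∈ N lies in every open normal V containing
the relations (`mem_of_conj_eq_pow_galCyclotomicCharacter`). The image A of ker φ in G/V is a finite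
abelian p-group on which G acts by conjugation through φ, just as G acts on roots of unity. If τ ∉
V, some character χ of A with values in M^× is nontrivial at τ. The hypotheses on roots of unity put
φ(G) inside 1 + p^k ℤ_p and provide σ such that the powers of φ(σ) are dense there. This lets the
projection ker φ → A extend to a crossed homomorphism a : G → A. Then χ ∘ a is a cocycle of roots of
unity, and Hilbert 90 writes it as g ↦ y / g(y). A p-power of y lies in F, so τ fixes y, which
forces χ(τ) = 1, a contradiction. -/

/-! ### Membership in the maximal p-extension. -/

theorem Subgroup.mem_of_pow_mem_of_coprime {G : Type*} [Group G] (S : Subgroup G) {g : G}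
    {a b : ℕ} (hab : a.Coprime b) (ha : g ^ a ∈ S) (hb : g ^ b ∈ S) : g ∈ S := by
  have h : g = (g ^ a) ^ (a.gcdA b) * (g ^ b) ^ (a.gcdB b) := by
    rw [← zpow_natCast, ← zpow_natCast, ← zpow_mul, ← zpow_mul, ← zpow_add,
      ← Nat.gcd_eq_gcd_ab, hab]
    simp
  rw [h]
  exact S.mul_mem (S.zpow_mem ha _) (S.zpow_mem hb _)

theorem Subgroup.isPGroup_quotient_closure_coprime {G : Type*} [Group G] [Finite G] (p : ℕ)
    [hp : Fact p.Prime] (S : Subgroup G) [S.Normal]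
    (hS : ∀ g : G, (orderOf g).Coprime p → g ∈ S) : IsPGroup p (G ⧸ S) := by
  intro q
  obtain ⟨g, rfl⟩ := QuotientGroup.mk_surjective q
  obtain ⟨n, m, hm, hnm⟩ := Nat.exists_eq_pow_mul_and_not_dvd
    (orderOf_pos g).ne' p hp.out.ne_one
  refine ⟨n, ?_⟩
  rw [← QuotientGroup.mk_pow, QuotientGroup.eq_one_iff]
  refine hS _ ?_
  rw [orderOf_pow_of_dvd (pow_ne_zero _ hp.out.ne_zero) ⟨m, hnm⟩, hnm,
    Nat.mul_div_cancel_left _ (pow_pos hp.out.pos n)]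
  exact ((hp.out.coprime_iff_not_dvd).mpr hm).symm

theorem le_maximalPExtension (p : ℕ) {K Ω : Type*} [Field K] [Field Ω] [Algebra K Ω]
    (E : IntermediateField K Ω) [FiniteDimensional K E] [IsGalois K E] {n : ℕ}
    (hn : Module.finrank K E = p ^ n) : E ≤ maximalPExtension p K Ω :=
  le_iSup (fun E : {E : IntermediateField K Ω //
    FiniteDimensional K E ∧ IsGalois K E ∧ ∃ n : ℕ, Module.finrank K E = p ^ n} => E.1)
    ⟨E, inferInstance, inferInstance, n, hn⟩

theorem exists_pow_fix_of_mem (p : ℕ) [Fact p.Prime] {K Ω : Type*} [Field K] [Field Ω]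
    [Algebra K Ω] {x : Ω} (hx : x ∈ maximalPExtension p K Ω) (g : Gal(Ω/K)) :
    ∃ n : ℕ, (g ^ p ^ n) x = x := by
  obtain ⟨n, hn⟩ := exists_pow_fix p K Ω ⟨x, hx⟩
  refine ⟨n, ?_⟩
  have h := AlgEquiv.restrictNormal_commutes (g ^ p ^ n) (maximalPExtension p K Ω) ⟨x, hx⟩
  change algebraMap _ _ (AlgEquiv.restrictNormalHom (maximalPExtension p K Ω) (g ^ p ^ n) _) = _ at h
  rw [map_pow, hn _ n le_rfl] at h
  exact h.symm

/-- The automorphisms of order prime to p generate a normal subgroup with p-group quotient, so its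
fixed field is Galois of p-power degree over F. -/
theorem mem_maximalPExtension_of_forall_coprime (p : ℕ) [Fact p.Prime] {F Ω : Type*} [Field F]
    [Field Ω] [Algebra F Ω] (T : IntermediateField F Ω) [FiniteDimensional F T] [IsGalois F T]
    (x : T) (h : ∀ g : Gal(T/F), (orderOf g).Coprime p → g x = x) :
    (x : Ω) ∈ maximalPExtension p F Ω := by
  let S : Subgroup Gal(T/F) := Subgroup.closure {g | (orderOf g).Coprime p}
  have hSn : S.Normal := by
    have : Subgroup.normalClosure {g : Gal(T/F) | (orderOf g).Coprime p} = S := by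
      refine congrArg Subgroup.closure (Set.Subset.antisymm ?_ Group.subset_conjugatesOfSet)
      intro g hg
      obtain ⟨a, ha, hag⟩ := Group.mem_conjugatesOfSet_iff.mp hg
      obtain ⟨c, rfl⟩ := isConj_iff.mp hag
      have := orderOf_injective (MulAut.conj c).toMonoidHom (MulAut.conj c).injective a
      simp only [MulEquiv.toMonoidHom_eq_coe, MonoidHom.coe_coe, MulAut.conj_apply] at this
      simpa [this] using ha
    rw [← this]
    infer_instance
  let E := IntermediateField.fixedField S
  have hE : IsGalois F E := IsGalois.of_fixedField_normal_subgroup S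
  obtain ⟨n, hn⟩ := IsPGroup.iff_card.mp (S.isPGroup_quotient_closure_coprime p
    fun g hg => Subgroup.subset_closure hg)
  have hcard : Module.finrank F E = p ^ n := by
    refine (IntermediateField.finrank_eq_fixingSubgroup_index _ E).trans ?_
    rw [← hn, IntermediateField.fixingSubgroup_fixedField]
    rfl
  have e : E ≃ₐ[F] IntermediateField.lift E := IntermediateField.liftAlgEquiv E
  have : FiniteDimensional F (IntermediateField.lift E) := e.toLinearEquiv.finiteDimensional
  have : IsGalois F (IntermediateField.lift E) := IsGalois.of_algEquiv e
  refine le_maximalPExtension p (IntermediateField.lift E) (n := n)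
    (by rw [← hcard, e.toLinearEquiv.finrank_eq]) ?_
  refine ⟨x, ?_, rfl⟩
  have hS : S ≤ MulAction.stabilizer Gal(T/F) x := (Subgroup.closure_le _).mpr h
  intro g
  exact hS g.2

/-- Let T be the Galois closure of x. An element g of Gal(T/F) of order prime to p fixes T ∩ F(p),
because each element there is fixed by some p-power of g. Hence g lifts to an automorphism trivial
on F(p), some p-power of g fixes x, and so g does too. -/
theorem mem_maximalPExtension_of_forall_pow_fix (p : ℕ) [Fact p.Prime] {F Ω : Type*} [Field F]
    [Field Ω] [Algebra F Ω] [IsGalois F Ω] (x : Ω)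
    (h : ∀ g : Gal(Ω/F), (∀ y ∈ maximalPExtension p F Ω, g y = y) → ∃ n : ℕ, (g ^ p ^ n) x = x) :
    x ∈ maximalPExtension p F Ω := by
  let T : IntermediateField F Ω := (FiniteGaloisIntermediateField.adjoin F {x}).1
  have hxT : x ∈ T := FiniteGaloisIntermediateField.subset_adjoin F {x} rfl
  have : FiniteDimensional F T := inferInstanceAs
    (FiniteDimensional F (FiniteGaloisIntermediateField.adjoin F {x}))
  have : IsGalois F T := inferInstanceAs (IsGalois F (FiniteGaloisIntermediateField.adjoin F {x}))
  let r : Gal(Ω/F) →* Gal(T/F) := AlgEquiv.restrictNormalHom T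
  have hr : ∀ g (y : T), ((r g y : T) : Ω) = g y := fun g y =>
    AlgEquiv.restrictNormal_commutes g T y
  have hfix : ∀ (g : Gal(T/F)) (y : T) (a : ℕ), (orderOf g).Coprime (p ^ a) →
      (g ^ p ^ a) y = y → g y = y := by
    intro g y a hg hy
    have := (MulAction.stabilizer Gal(T/F) y).mem_of_pow_mem_of_coprime hg
      (by rw [pow_orderOf_eq_one]; exact one_mem _) hy
    exact this
  refine mem_maximalPExtension_of_forall_coprime p T ⟨x, hxT⟩ fun g hg => ?_
  let J : Subgroup Gal(T/F) := (maximalPExtension p F Ω).fixingSubgroup.map r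
  have hgJ : g ∈ J := by
    rw [← IntermediateField.fixingSubgroup_fixedField J, IntermediateField.mem_fixingSubgroup_iff]
    intro y hy
    have hyp : (y : Ω) ∈ maximalPExtension p F Ω := by
      rw [← InfiniteGalois.fixedField_fixingSubgroup (maximalPExtension p F Ω)]
      rintro ⟨s, hs⟩
      have := hy ⟨r s, s, hs, rfl⟩
      exact (hr s y).symm.trans (congrArg Subtype.val this)
    obtain ⟨s, rfl⟩ := AlgEquiv.restrictNormalHom_surjective (F := F) (K₁ := T) Ω g
    obtain ⟨n, hn⟩ := exists_pow_fix_of_mem p hyp s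
    refine hfix _ y n (hg.pow_right n) (Subtype.ext ?_)
    change ((((r s) ^ p ^ n) y : T) : Ω) = y
    rw [← map_pow, hr, hn]
  obtain ⟨s, hs, rfl⟩ := hgJ
  obtain ⟨n, hn⟩ := h s ((IntermediateField.mem_fixingSubgroup_iff _ _).mp hs)
  refine hfix _ _ n (hg.pow_right n) (Subtype.ext ?_)
  rw [← map_pow, hr]
  exact hn

/-- `F(p)` is `p`-closed: it contains the maximal `p`-extensions of its subfields. -/
theorem maximalPExtension_subset_of_le (p : ℕ) [Fact p.Prime] {F Ω : Type*} [Field F]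
    [Field Ω] [Algebra F Ω] [IsGalois F Ω] {K : IntermediateField F Ω}
    (hK : K ≤ maximalPExtension p F Ω) {x : Ω} (hx : x ∈ maximalPExtension p K Ω) :
    x ∈ maximalPExtension p F Ω := by
  refine mem_maximalPExtension_of_forall_pow_fix p x fun g hg => ?_
  let g' : Gal(Ω/K) := AlgEquiv.ofRingEquiv (f := g.toRingEquiv) fun y => hg y (hK y.2)
  obtain ⟨n, hn⟩ := exists_pow_fix_of_mem p hx g'
  refine ⟨n, ?_⟩
  have : ∀ m : ℕ, ∀ z, (g ^ m) z = (g' ^ m) z := by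
    intro m
    induction m with
    | zero => intro z; rfl
    | succ m ih => intro z; rw [pow_succ, pow_succ]; exact ih (g z)
  rw [this, hn]

/-! ### Radicals and roots of unity in F(p). -/

theorem mem_maximalPExtension_of_pow_mem {p : ℕ} [hp : Fact p.Prime] {F Ω : Type*} [Field F]
    [Field Ω] [Algebra F Ω] [IsGalois F Ω] {ζ : F} (hζ : IsPrimitiveRoot ζ p) {y : Ω}
    (hy : y ^ p ∈ maximalPExtension p F Ω) : y ∈ maximalPExtension p F Ω := by
  by_cases hy0 : y = 0
  · rw [hy0]; exact zero_mem _
  -- The exponent 1 suffices: `g` multiplies `y` by a p-th root of unity lying in F, so `g ^ p`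
  -- fixes `y`.
  refine mem_maximalPExtension_of_forall_pow_fix p y fun g hg => ⟨1, ?_⟩
  have hζ' := hζ.map_of_injective (algebraMap F Ω).injective
  have h1 : (g y / y) ^ p = 1 := by
    rw [div_pow, ← map_pow, hg _ hy, div_self (pow_ne_zero _ hy0)]
  obtain ⟨i, -, hi⟩ := hζ'.eq_pow_of_pow_eq_one h1
  rw [← map_pow] at hi
  have h2 : g y = algebraMap F Ω (ζ ^ i) * y := by rw [hi, div_mul_cancel₀ _ hy0]
  have h3 : ∀ m : ℕ, (g ^ m) y = algebraMap F Ω (ζ ^ i) ^ m * y := by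
    intro m
    induction m with
    | zero => simp
    | succ m ih =>
      rw [pow_succ']
      change g ((g ^ m) y) = _
      rw [ih, map_mul, map_pow, g.commutes, h2, pow_succ, mul_assoc]
  rw [h3, pow_one, ← map_pow, ← pow_mul, mul_comm i, pow_mul, hζ.pow_eq_one, one_pow, map_one,
    one_mul]

theorem mem_maximalPExtension_of_pow_pow_mem {p : ℕ} [hp : Fact p.Prime] {F Ω : Type*} [Field F]
    [Field Ω] [Algebra F Ω] [IsGalois F Ω] {ζ : F} (hζ : IsPrimitiveRoot ζ p) {y : Ω} {m : ℕ}
    (hy : y ^ p ^ m ∈ maximalPExtension p F Ω) : y ∈ maximalPExtension p F Ω := by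
  induction m with
  | zero => simpa using hy
  | succ m ih => exact ih (mem_maximalPExtension_of_pow_mem hζ (by rwa [← pow_mul, ← pow_succ]))

theorem cyclotomicRadicalExtension_le {p : ℕ} [hp : Fact p.Prime] {F Ω : Type*} [Field F]
    [Field Ω] [Algebra F Ω] [IsGalois F Ω] {ζ : F} (hζ : IsPrimitiveRoot ζ p) :
    cyclotomicRadicalExtension p F Ω ≤ maximalPExtension p F Ω := by
  refine iSup_le fun m => iSup_le fun a => IntermediateField.adjoin_le_iff.mpr ?_
  rintro x (hx | hx)
  · refine mem_maximalPExtension_of_pow_pow_mem hζ (m := m) ?_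
    rw [show x ^ p ^ m = _ from hx]
    exact (maximalPExtension p F Ω).algebraMap_mem _
  · refine mem_maximalPExtension_of_pow_pow_mem hζ (m := m) ?_
    rw [show x ^ p ^ m = _ from hx]
    exact one_mem _

theorem exists_isPrimitiveRoot_of_isSepClosed (p : ℕ) [Fact p.Prime] (Ω : Type*) [Field Ω]
    [IsSepClosed Ω] (hpΩ : (p : Ω) ≠ 0) (n : ℕ) : ∃ ζ : Ω, IsPrimitiveRoot ζ (p ^ n) := by
  have : NeZero ((p ^ n : ℕ) : Ω) := ⟨by push_cast; exact pow_ne_zero n hpΩ⟩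
  exact HasEnoughRootsOfUnity.exists_primitiveRoot Ω (p ^ n)

theorem hasEnoughRootsOfUnity_maximalPExtension {p : ℕ} [hp : Fact p.Prime] {F Ω : Type*} [Field F]
    [Field Ω] [Algebra F Ω] [IsSepClosure F Ω] {ζ : F} (hζ : IsPrimitiveRoot ζ p) (n : ℕ) :
    HasEnoughRootsOfUnity (maximalPExtension p F Ω) (p ^ n) := by
  have : IsSepClosed Ω := IsSepClosure.sep_closed F
  have hpF : (p : Ω) ≠ 0 := by
    have : NeZero ((p : ℕ) : F) := hζ.neZero'
    rw [← map_natCast (algebraMap F Ω)]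
    exact (map_ne_zero _).mpr (NeZero.ne _)
  obtain ⟨z, hz⟩ := exists_isPrimitiveRoot_of_isSepClosed p Ω hpF n
  have : NeZero p := ⟨hp.out.ne_zero⟩
  refine ⟨⟨⟨z, mem_maximalPExtension_of_pow_pow_mem hζ (m := n)
    (by rw [hz.pow_eq_one]; exact one_mem _)⟩, ?_⟩, rootsOfUnity.isCyclic _ _⟩
  exact IsPrimitiveRoot.of_map_of_injective (f := algebraMap (maximalPExtension p F Ω) Ω)
    (by exact hz) (algebraMap (maximalPExtension p F Ω) Ω).injective

/-! ### Principal units of ℤ_p. -/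

theorem PadicInt.dvd_iff_toZModPow_eq {p : ℕ} [Fact p.Prime] (n : ℕ) (x y : ℤ_[p]) :
    (p : ℤ_[p]) ^ n ∣ x - y ↔ PadicInt.toZModPow n x = PadicInt.toZModPow n y := by
  rw [← sub_eq_zero (a := PadicInt.toZModPow n x), ← map_sub, ← RingHom.mem_ker,
    PadicInt.ker_toZModPow, Ideal.mem_span_singleton]

theorem PadicInt.toZModPow_eq_of_le {p : ℕ} [Fact p.Prime] {m n : ℕ} (h : m ≤ n) {x y : ℤ_[p]}
    (hxy : PadicInt.toZModPow n x = PadicInt.toZModPow n y) :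
    PadicInt.toZModPow m x = PadicInt.toZModPow m y :=
  (dvd_iff_toZModPow_eq m x y).mp
    ((pow_dvd_pow _ h).trans ((dvd_iff_toZModPow_eq n x y).mpr hxy))

/-- Here u = 1 + p^k w with w a unit. For k ≥ 1 the bound `k + 2 ≤ p * k` excludes only p = 2, k =
1, where u = -1 is a counterexample. -/
theorem PadicInt.orderOf_toZModPow {p k : ℕ} [hp : Fact p.Prime] (hk0 : k ≠ 0)
    (hk : k + 2 ≤ p * k) (u : ℤ_[p]) (h1 : PadicInt.toZModPow k u = 1)
    (h2 : PadicInt.toZModPow (k + 1) u ≠ 1) (e : ℕ) :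
    orderOf (PadicInt.toZModPow (e + k) u) = p ^ e := by
  rw [← map_one (PadicInt.toZModPow k), ← dvd_iff_toZModPow_eq] at h1
  rw [← map_one (PadicInt.toZModPow (k + 1)), ne_eq, ← dvd_iff_toZModPow_eq] at h2
  obtain ⟨w, hw⟩ := h1
  have hwp : ¬ (p : ℤ_[p]) ∣ w := fun h => h2 (by rw [hw, pow_succ]; exact mul_dvd_mul_left _ h)
  have hwu : IsUnit w := by
    rw [PadicInt.isUnit_iff]
    refine le_antisymm (PadicInt.norm_le_one w) (not_lt.mp fun h => hwp ?_)
    exact (PadicInt.norm_lt_one_iff_dvd w).mp h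
  have hN : e + k ≠ 0 := by omega
  have : NeZero (p ^ (e + k)) := ⟨pow_ne_zero _ hp.out.ne_zero⟩
  set a := (PadicInt.toZModPow (e + k) w).val with ha
  have haw : PadicInt.toZModPow (e + k) w = (a : ZMod (p ^ (e + k))) := by
    rw [ha, ZMod.natCast_zmod_val]
  have hau : ¬ (p : ℤ) ∣ (a : ℤ) := by
    have := hwu.map (PadicInt.toZModPow (e + k))
    rw [haw, ZMod.isUnit_iff_coprime, Nat.coprime_pow_right_iff (Nat.pos_of_ne_zero hN)] at this
    rw [Int.natCast_dvd_natCast]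
    exact hp.out.coprime_iff_not_dvd.mp this.symm
  have := ZMod.orderOf_one_add_mul_prime_pow hp.out k hk0 hk a hau e
  rw [← this]
  congr 1
  rw [show u = 1 + p ^ k * w by linear_combination hw]
  simp [haw]

theorem ZMod.card_ker_unitsMap {p k : ℕ} [hp : Fact p.Prime] (hk0 : k ≠ 0) (e : ℕ) :
    Nat.card (ZMod.unitsMap (pow_dvd_pow p (Nat.le_add_left k e))).ker = p ^ e := by
  have : NeZero (p ^ (e + k)) := ⟨pow_ne_zero _ hp.out.ne_zero⟩
  have : NeZero (p ^ k) := ⟨pow_ne_zero _ hp.out.ne_zero⟩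
  have h := Subgroup.card_eq_card_quotient_mul_card_subgroup
    (ZMod.unitsMap (pow_dvd_pow p (Nat.le_add_left k e))).ker
  rw [Nat.card_congr (QuotientGroup.quotientKerEquivOfSurjective _
    (ZMod.unitsMap_surjective (pow_dvd_pow p (Nat.le_add_left k e)))).toEquiv,
    Nat.card_eq_fintype_card, Nat.card_eq_fintype_card, ZMod.card_units_eq_totient,
    ZMod.card_units_eq_totient, Nat.totient_prime_pow hp.out (by omega),
    Nat.totient_prime_pow hp.out (by omega), show e + k - 1 = (k - 1) + e by omega, pow_add] at h
  have h0 : p ^ (k - 1) * (p - 1) ≠ 0 :=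
    mul_ne_zero (pow_ne_zero _ hp.out.ne_zero) (Nat.sub_ne_zero_of_lt hp.out.one_lt)
  refine (mul_left_cancel₀ h0 ?_).symm
  rw [← h]
  ring

/-- The principal units `1 + p ^ k ℤ_p` are topologically generated by any element which is not
in `1 + p ^ (k + 1) ℤ_p`. -/
theorem PadicInt.exists_toZModPow_eq_pow {p k : ℕ} [hp : Fact p.Prime] (hk0 : k ≠ 0)
    (hk : k + 2 ≤ p * k) (u : ℤ_[p]ˣ) (h1 : PadicInt.toZModPow k (u : ℤ_[p]) = 1)
    (h2 : PadicInt.toZModPow (k + 1) (u : ℤ_[p]) ≠ 1) (N : ℕ) (v : ℤ_[p]ˣ)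
    (hv : PadicInt.toZModPow k (v : ℤ_[p]) = 1) :
    ∃ i : ℕ, PadicInt.toZModPow N (v : ℤ_[p]) = PadicInt.toZModPow N ((u ^ i : ℤ_[p]ˣ) : ℤ_[p]) := by
  suffices h : ∃ i : ℕ, PadicInt.toZModPow (N + k) (v : ℤ_[p]) =
      PadicInt.toZModPow (N + k) ((u ^ i : ℤ_[p]ˣ) : ℤ_[p]) by
    obtain ⟨i, hi⟩ := h
    exact ⟨i, toZModPow_eq_of_le (Nat.le_add_right N k) hi⟩
  have : NeZero (p ^ (N + k)) := ⟨pow_ne_zero _ hp.out.ne_zero⟩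
  let f : ℤ_[p]ˣ →* (ZMod (p ^ (N + k)))ˣ := Units.map (PadicInt.toZModPow (N + k)).toMonoidHom
  have hker : ∀ w : ℤ_[p]ˣ, PadicInt.toZModPow k (w : ℤ_[p]) = 1 →
      f w ∈ (ZMod.unitsMap (pow_dvd_pow p (Nat.le_add_left k N))).ker := by
    intro w hw
    rw [MonoidHom.mem_ker]
    ext
    rw [ZMod.unitsMap_val, Units.val_one, ← hw]
    exact PadicInt.cast_toZModPow _ _ (Nat.le_add_left k N) _
  have hord : orderOf (f u) = p ^ N := by
    rw [← orderOf_units]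
    exact orderOf_toZModPow hk0 hk u h1 h2 N
  -- The kernel of reduction has order `p ^ N`, which is also the order of `f u`; so `f u` generates
  -- it.
  have heq : Subgroup.zpowers (f u) =
      (ZMod.unitsMap (pow_dvd_pow p (Nat.le_add_left k N))).ker := by
    refine Subgroup.eq_of_le_of_card_ge (Subgroup.zpowers_le.mpr (hker u h1)) ?_
    rw [Nat.card_zpowers, hord, ZMod.card_ker_unitsMap hk0]
  have hmem := hker v hv
  rw [← heq, ← mem_powers_iff_mem_zpowers] at hmem
  obtain ⟨i, hi⟩ := hmem
  refine ⟨i, ?_⟩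
  have h3 : f v = f (u ^ i) := by rw [map_pow]; exact hi.symm
  exact congrArg Units.val h3

theorem PadicInt.pow_dvd_of_toZModPow_pow_eq {p k : ℕ} [hp : Fact p.Prime] (hk0 : k ≠ 0)
    (hk : k + 2 ≤ p * k) (u : ℤ_[p]ˣ) (h1 : PadicInt.toZModPow k (u : ℤ_[p]) = 1)
    (h2 : PadicInt.toZModPow (k + 1) (u : ℤ_[p]) ≠ 1) {e i : ℕ}
    (hi : PadicInt.toZModPow (e + k) ((u ^ i : ℤ_[p]ˣ) : ℤ_[p]) = 1) : p ^ e ∣ i := by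
  rw [← orderOf_toZModPow hk0 hk u h1 h2 e]
  refine orderOf_dvd_of_pow_eq_one ?_
  rw [← map_pow, ← hi, Units.val_pow_eq_pow_val]

/-! ### Approximation and conjugation of p-adic powers. -/

theorem exists_zpow_eq_padicPow_mod (p : ℕ) [hp : Fact p.Prime] (K Ω : Type*) [Field K] [Field Ω]
    [Algebra K Ω] [Algebra.IsSeparable K Ω] (g : proPGaloisGroup p K Ω) (z : ℤ_[p]) (m : ℕ)
    {U : Set (proPGaloisGroup p K Ω)} (hU : U ∈ 𝓝 (padicPow g z)) :
    ∃ n : ℤ, PadicInt.toZModPow m (n : ℤ_[p]) = PadicInt.toZModPow m z ∧ g ^ n ∈ U := by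
  have hne : (comap (Int.cast : ℤ → ℤ_[p]) (𝓝 z)).NeBot :=
    comap_neBot_iff.mpr fun t ht => by
      obtain ⟨_, hy, n, rfl⟩ := mem_closure_iff_nhds.mp (PadicInt.denseRange_intCast z) t ht
      exact ⟨n, hy⟩
  have hp0 : (0 : ℝ) < p := by exact_mod_cast hp.out.pos
  have h1 : ∀ᶠ n : ℤ in comap (Int.cast : ℤ → ℤ_[p]) (𝓝 z),
      PadicInt.toZModPow m (n : ℤ_[p]) = PadicInt.toZModPow m z := by
    filter_upwards [preimage_mem_comap (Metric.ball_mem_nhds z (zpow_pos hp0 (-(m : ℤ) + 1)))]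
      with n hn
    rw [← PadicInt.dvd_iff_toZModPow_eq, ← Ideal.mem_span_singleton,
      ← PadicInt.norm_le_pow_iff_mem_span_pow, PadicInt.norm_le_pow_iff_norm_lt_pow_add_one]
    exact mem_ball_iff_norm.mp hn
  exact (h1.and ((tendsto_padicPow p K Ω g z).eventually hU)).exists

theorem conj_padicPow (p : ℕ) [hp : Fact p.Prime] (K Ω : Type*) [Field K] [Field Ω]
    [Algebra K Ω] [Algebra.IsSeparable K Ω] (h g : proPGaloisGroup p K Ω) (z : ℤ_[p]) :
    h * padicPow g z * h⁻¹ = padicPow (h * g * h⁻¹) z := by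
  have : IsGalois K (maximalPExtension p K Ω) := ⟨⟩
  have hne : (comap (Int.cast : ℤ → ℤ_[p]) (𝓝 z)).NeBot :=
    comap_neBot_iff.mpr fun t ht => by
      obtain ⟨_, hy, n, rfl⟩ := mem_closure_iff_nhds.mp (PadicInt.denseRange_intCast z) t ht
      exact ⟨n, hy⟩
  refine tendsto_nhds_unique (f := fun n : ℤ => (h * g * h⁻¹) ^ n) ?_
    (tendsto_padicPow p K Ω (h * g * h⁻¹) z)
  have hc : Continuous fun x : proPGaloisGroup p K Ω => h * x * h⁻¹ := by fun_prop
  refine ((hc.tendsto _).comp (tendsto_padicPow p K Ω g z)).congr fun n => ?_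
  simp only [Function.comp_apply, conj_zpow]

/-! ### Hilbert 90. -/

/-- Hilbert's Theorem 90 for cocycles which are inflated from a finite quotient. -/
theorem exists_ne_zero_of_mulCocycle {F M : Type*} [Field F] [Field M] [Algebra F M] [Normal F M]
    (c : Gal(M/F) → Mˣ) (hc : ∀ g h, (c (g * h) : M) = c g * g (c h))
    (T : IntermediateField F M) [FiniteDimensional F T] [Normal F T]
    (hT : ∀ g h : Gal(M/F), (∀ y ∈ T, g y = h y) → c g = c h) :
    ∃ y : M, y ≠ 0 ∧ ∀ g : Gal(M/F), c g * g y = y := by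
  have hres : ∀ (g : Gal(M/F)) (y : T), ((AlgEquiv.restrictNormalHom T g y : T) : M) = g y :=
    fun g y => AlgEquiv.restrictNormal_commutes g T y
  choose s hs using AlgEquiv.restrictNormalHom_surjective (F := F) (K₁ := T) M
  have hsy : ∀ (g : Gal(T/F)) (y : T), s g y = (g y : M) := fun g y => by
    rw [← hres, hs]
  -- By Dedekind independence over M, some `z` makes the resolvent sum nonzero even though its
  -- coefficients need not lie in `T`.
  have hli : LinearIndependent M (fun g : Gal(T/F) => (fun y : T => ((g y : T) : M))) :=
    (linearIndependent_monoidHom T M).comp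
      (fun g : Gal(T/F) => ((algebraMap T M).comp (g : T →+* T) : T →+* M).toMonoidHom)
      (fun g h hgh => by
        ext y
        exact DFunLike.congr_fun hgh y)
  obtain ⟨z, hz⟩ : ∃ z : T, ∑ g : Gal(T/F), (c (s g) : M) * (g z : M) ≠ 0 := by
    by_contra! H
    refine (c (s 1)).ne_zero (Fintype.linearIndependent_iff.mp hli (fun g => (c (s g) : M)) ?_ 1)
    ext z
    simpa using H z
  refine ⟨_, hz, fun g => ?_⟩
  rw [map_sum, Finset.mul_sum]
  refine Fintype.sum_bijective (fun h => AlgEquiv.restrictNormalHom T g * h)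
    (Group.mulLeft_bijective _) _ _ fun h => ?_
  rw [map_mul, ← mul_assoc, ← hc, AlgEquiv.mul_apply, hres]
  congr 2
  -- The product `g * s h` and the chosen lift of its restriction agree on `T`, so `c` takes the
  -- same value on both.
  refine hT _ _ fun y hy => ?_
  rw [AlgEquiv.mul_apply, hsy h ⟨y, hy⟩, hsy _ ⟨y, hy⟩, AlgEquiv.mul_apply, hres]

/-! ### The cyclotomic character. -/

section Cyclotomic

variable {p : ℕ} [hp : Fact p.Prime] {F M : Type*} [Field F] [Field M] [Algebra F M]

/-- The `p`-cyclotomic character on the Galois group of an arbitrary extension. -/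
noncomputable def galCyclotomicCharacter (p : ℕ) [Fact p.Prime] (F M : Type*) [Field F] [Field M]
    [Algebra F M] : Gal(M/F) →* ℤ_[p]ˣ :=
  (cyclotomicCharacter M p).comp (MulSemiringAction.toRingAut Gal(M/F) M)

/-- Compactness: ker φ is the intersection of the descending closed sets {φ ≡ 1 mod p^j}, so one of
these already lies in the open set `B`. -/
theorem exists_forall_mem_of_ker_galCyclotomicCharacter_le [IsGalois F M]
    (B : Subgroup Gal(M/F))
    (hB : IsOpen (B : Set Gal(M/F))) (hker : (galCyclotomicCharacter p F M).ker ≤ B) :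
    ∃ j : ℕ, ∀ g : Gal(M/F),
      PadicInt.toZModPow j (galCyclotomicCharacter p F M g : ℤ_[p]) = 1 → g ∈ B := by
  have hcont : Continuous fun g : Gal(M/F) => (galCyclotomicCharacter p F M g : ℤ_[p]) :=
    Units.continuous_val.comp (cyclotomicCharacter.continuous p F M)
  refine exists_subset_nhds_of_isCompact' (X := Gal(M/F)) (V := fun j : ℕ =>
    {g | PadicInt.toZModPow j (galCyclotomicCharacter p F M g : ℤ_[p]) = 1}) ?_ ?_ ?_
    (U := (B : Set Gal(M/F))) ?_
  · refine directed_of_isDirected_le fun i j hij g hg => ?_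
    have hg' : PadicInt.toZModPow j (galCyclotomicCharacter p F M g : ℤ_[p]) = 1 := hg
    rw [← map_one (PadicInt.toZModPow j)] at hg'
    exact (PadicInt.toZModPow_eq_of_le hij hg').trans (map_one _)
  all_goals
    have hclosed : ∀ j : ℕ, IsClosed
        {g : Gal(M/F) | PadicInt.toZModPow j (galCyclotomicCharacter p F M g : ℤ_[p]) = 1} := by
      intro j
      have : {g : Gal(M/F) | PadicInt.toZModPow j (galCyclotomicCharacter p F M g : ℤ_[p]) = 1} =
          {g | ‖(galCyclotomicCharacter p F M g : ℤ_[p]) - 1‖ ≤ (p : ℝ) ^ (-(j : ℤ))} := by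
        ext g
        rw [Set.mem_ofPred_eq, Set.mem_ofPred_eq, PadicInt.norm_le_pow_iff_mem_span_pow,
          Ideal.mem_span_singleton, PadicInt.dvd_iff_toZModPow_eq, map_one]
      rw [this]
      exact isClosed_le (by fun_prop) continuous_const
  · exact fun j => (hclosed j).isCompact
  · exact hclosed
  · intro g hg
    refine hB.mem_nhds (hker ?_)
    rw [MonoidHom.mem_ker]
    ext1
    rw [Units.val_one]
    refine PadicInt.ext_of_toZModPow.mp fun n => ?_
    rw [map_one]
    exact Set.mem_iInter.mp hg n

variable [∀ i, HasEnoughRootsOfUnity M (p ^ i)]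

theorem galCyclotomicCharacter_spec (g : Gal(M/F)) {t : M} {n : ℕ} (ht : t ^ p ^ n = 1) :
    g t = t ^ (PadicInt.toZModPow n (galCyclotomicCharacter p F M g : ℤ_[p])).val :=
  cyclotomicCharacter.spec p (MulSemiringAction.toRingAut Gal(M/F) M g) t ht

theorem pow_eq_of_toZModPow_natCast_eq (g : Gal(M/F)) {t : M} {n N : ℕ} (ht : t ^ p ^ n = 1)
    (hN : PadicInt.toZModPow n (N : ℤ_[p]) =
      PadicInt.toZModPow n (galCyclotomicCharacter p F M g : ℤ_[p])) : g t = t ^ N := by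
  rw [galCyclotomicCharacter_spec g ht, ← hN, map_natCast, ZMod.val_natCast]
  exact (pow_eq_pow_mod N ht).symm

theorem galCyclotomicCharacter_toZModPow_eq_one_iff (g : Gal(M/F)) {ζ : M} {n : ℕ}
    (hζ : IsPrimitiveRoot ζ (p ^ n)) :
    PadicInt.toZModPow n (galCyclotomicCharacter p F M g : ℤ_[p]) = 1 ↔ g ζ = ζ := by
  have : NeZero (p ^ n) := ⟨pow_ne_zero _ hp.out.ne_zero⟩
  constructor
  · intro h
    rw [pow_eq_of_toZModPow_natCast_eq (N := 1) g hζ.pow_eq_one (by rw [h]; simp), pow_one]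
  · intro h
    rw [galCyclotomicCharacter_spec g hζ.pow_eq_one] at h
    have h2 : ζ ^ (PadicInt.toZModPow n (galCyclotomicCharacter p F M g : ℤ_[p])).val = ζ ^ 1 := by
      rw [h, pow_one]
    obtain ⟨u, rfl⟩ := hζ.isUnit NeZero.out
    rw [← Units.val_pow_eq_pow_val, ← Units.val_pow_eq_pow_val, Units.val_inj,
      pow_eq_pow_iff_modEq, ← (IsPrimitiveRoot.coe_units_iff.mp hζ).eq_orderOf] at h2
    have := (ZMod.natCast_eq_natCast_iff _ _ _).mpr h2
    simpa using this

variable [IsGalois F M]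

/-- Otherwise a primitive p^n-th root of unity in M would be Galois-invariant. With n = k + 1 this
supplies the automorphism σ whose cyclotomic value generates. -/
theorem exists_galCyclotomicCharacter_toZModPow_ne_one {n : ℕ}
    (hn : ¬ ∃ ζ : F, IsPrimitiveRoot ζ (p ^ n)) :
    ∃ g : Gal(M/F), PadicInt.toZModPow n (galCyclotomicCharacter p F M g : ℤ_[p]) ≠ 1 := by
  by_contra! H
  obtain ⟨ζ, hζ⟩ := HasEnoughRootsOfUnity.exists_primitiveRoot M (p ^ n)
  have : ζ ∈ (⊥ : IntermediateField F M) := by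
    rw [InfiniteGalois.mem_bot_iff_fixed]
    exact fun g => (galCyclotomicCharacter_toZModPow_eq_one_iff g hζ).mp (H g)
  obtain ⟨z, rfl⟩ := IntermediateField.mem_bot.mp this
  exact hn ⟨z, hζ.of_map_of_injective (algebraMap F M).injective⟩

end Cyclotomic

/-! ### Extending a character of ker φ to a cocycle. -/

/-- A section of `ψ` along a generator gives a crossed homomorphism to a subgroup of `Q`. -/
theorem exists_crossedHom_of_generator {G Q C : Type*} [Group G] [Group Q] [Group C] (π : G →* Q)
    (ψ : G →* C) (A : Subgroup Q) (hA : ∀ g, ψ g = 1 → π g ∈ A) (σ : G)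
    (hσ : ∀ g, ∃ i : ℕ, ψ g = ψ σ ^ i)
    (hπσ : ∀ i j : ℕ, ψ σ ^ i = ψ σ ^ j → π σ ^ i = π σ ^ j) :
    ∃ a : G → A,
      (∀ g h, ∃ s, ψ s = ψ g ∧ (a (g * h) : Q) = a g * (π s * a h * (π s)⁻¹)) ∧
      (∀ g h, π g = π h → ψ g = ψ h → a g = a h) ∧ ∀ g, ψ g = 1 → (a g : Q) = π g := by
  choose i hi using hσ
  -- The crossed homomorphism divides `π g` by the power of `π σ` with the same ψ-value; `hπσ` makes
  -- this independent of the exponent chosen. It is twisted by conjugation with `π σ ^ i g`, where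
  -- `σ ^ i g` has the same ψ-value as `g`.
  have ha : ∀ g, π g * (π σ ^ i g)⁻¹ ∈ A := by
    intro g
    have := hA (g * (σ ^ i g)⁻¹) (by rw [map_mul, map_inv, map_pow, ← hi g, mul_inv_cancel])
    simpa using this
  refine ⟨fun g => ⟨_, ha g⟩, fun g h => ⟨σ ^ i g, by rw [map_pow, ← hi g], ?_⟩,
    fun g h h1 h2 => Subtype.ext ?_, fun g hg => ?_⟩
  · have h2 : π σ ^ i (g * h) = π σ ^ (i g + i h) :=
      hπσ _ _ (by rw [← hi, map_mul, pow_add, ← hi g, ← hi h])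
    simp only [h2, map_mul, map_pow, pow_add]
    group
  · have h5 : π σ ^ i g = π σ ^ i h := hπσ _ _ (by rw [← hi, ← hi, h2])
    simp only [h1, h5]
  · have h3 : π σ ^ i g = π σ ^ 0 := hπσ _ _ (by rw [← hi, pow_zero, hg])
    simp only [h3, pow_zero, inv_one, mul_one]

theorem Subgroup.exists_monoidHom_units_apply_ne_one {Q M : Type*} [Group Q] [Finite Q]
    [Field M] {n : ℕ} [NeZero n] [HasEnoughRootsOfUnity M n] (A : Subgroup Q)
    (hcomm : ∀ x ∈ A, ∀ y ∈ A, x * y = y * x) (hn : ∀ x ∈ A, x ^ n = 1) {x : Q} (hx : x ∈ A)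
    (hx1 : x ≠ 1) : ∃ χ : A →* Mˣ, χ ⟨x, hx⟩ ≠ 1 := by
  let _ : CommGroup A :=
    { (inferInstance : Group A) with
      mul_comm := fun x y => Subtype.ext (hcomm x x.2 y y.2) }
  have hexp : Monoid.exponent A ∣ n := Monoid.exponent_dvd_of_forall_pow_eq_one fun q =>
    Subtype.ext (hn q q.2)
  have : HasEnoughRootsOfUnity M (Monoid.exponent A) := HasEnoughRootsOfUnity.of_dvd M hexp
  exact CommGroup.exists_apply_ne_one_of_hasEnoughRootsOfUnity A M
    (a := ⟨x, hx⟩) fun h => hx1 (congrArg Subtype.val h)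

/-- Let `V` be an open normal subgroup of `Gal(M/F)` modulo which `ker φ` is acted upon by
conjugation through the cyclotomic character `φ`. Then `V` contains every automorphism which fixes
all `p ^ m`-th roots in `M` of elements of `F`. -/
theorem mem_of_conj_eq_pow_galCyclotomicCharacter {p : ℕ} [hp : Fact p.Prime] {F M : Type*}
    [Field F] [Field M] [Algebra F M] [IsGalois F M] [∀ i, HasEnoughRootsOfUnity M (p ^ i)]
    {k : ℕ} (hk0 : k ≠ 0) (hkp : k + 2 ≤ p * k) (hk : ∃ ζ : F, IsPrimitiveRoot ζ (p ^ k))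
    (hk' : ¬ ∃ ζ : F, IsPrimitiveRoot ζ (p ^ (k + 1)))
    (V : Subgroup Gal(M/F)) [V.Normal] (hV : IsOpen (V : Set Gal(M/F))) {e : ℕ}
    (hVe : ∀ g : Gal(M/F), g ^ p ^ e ∈ V)
    (hrel : ∀ s : Gal(M/F), ∀ t ∈ (galCyclotomicCharacter p F M).ker, ∀ n : ℕ,
      PadicInt.toZModPow e (n : ℤ_[p]) =
        PadicInt.toZModPow e (galCyclotomicCharacter p F M s : ℤ_[p]) →
      s * t * s⁻¹ * (t ^ n)⁻¹ ∈ V)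
    {τ : Gal(M/F)}
    (hτ : ∀ (y : M) (m : ℕ), y ^ p ^ m ∈ (⊥ : IntermediateField F M) → τ y = y) : τ ∈ V := by
  set φ := galCyclotomicCharacter p F M with hφ
  have hpe : NeZero (p ^ e) := ⟨pow_ne_zero _ hp.out.ne_zero⟩
  have hφ1 : ∀ g : Gal(M/F), PadicInt.toZModPow k (φ g : ℤ_[p]) = 1 := by
    obtain ⟨ζ, hζ⟩ := hk
    exact fun g => (galCyclotomicCharacter_toZModPow_eq_one_iff g
      (hζ.map_of_injective (algebraMap F M).injective)).mpr (g.commutes ζ)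
  obtain ⟨σ, hσ⟩ := exists_galCyclotomicCharacter_toZModPow_ne_one (M := M) hk'
  have hτker : τ ∈ φ.ker := by
    rw [MonoidHom.mem_ker]
    ext1
    rw [Units.val_one]
    refine PadicInt.ext_of_toZModPow.mp fun n => ?_
    rw [map_one]
    obtain ⟨ζ, hζ⟩ := HasEnoughRootsOfUnity.exists_primitiveRoot M (p ^ n)
    exact (galCyclotomicCharacter_toZModPow_eq_one_iff τ hζ).mpr
      (hτ ζ n (by rw [hζ.pow_eq_one]; exact one_mem _))
  -- Modulo p^(e+k) the value φ(σ) has order exactly p^e, and p^e kills G/V. Hence `π σ ^ i` depends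
  -- only on `ψ σ ^ i`.
  let ψ : Gal(M/F) →* (ZMod (p ^ (e + k)))ˣ :=
    (Units.map (PadicInt.toZModPow (e + k)).toMonoidHom).comp φ
  have hψ : ∀ g h, ψ g = ψ h ↔ PadicInt.toZModPow (e + k) (φ g : ℤ_[p]) =
      PadicInt.toZModPow (e + k) (φ h : ℤ_[p]) := fun g h => Units.ext_iff
  have hψ1 : ∀ g, ψ g = 1 ↔ PadicInt.toZModPow (e + k) (φ g : ℤ_[p]) = 1 := fun g => Units.ext_iff
  let π : Gal(M/F) →* Gal(M/F) ⧸ V := QuotientGroup.mk' V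
  have hπ : ∀ g, π g = 1 ↔ g ∈ V := fun g => QuotientGroup.eq_one_iff g
  have hπpow : ∀ q, q ^ p ^ e = (1 : Gal(M/F) ⧸ V) := by
    intro q
    obtain ⟨g, rfl⟩ := QuotientGroup.mk'_surjective V q
    rw [← map_pow]
    exact (hπ _).mpr (hVe g)
  have hdiff : ∀ i j : ℕ, i ≤ j → ψ σ ^ i = ψ σ ^ j → π σ ^ i = π σ ^ j := by
    intro i j hij h
    obtain ⟨d, rfl⟩ := Nat.exists_eq_add_of_le hij
    rw [pow_add (ψ σ), left_eq_mul, ← map_pow, hψ1, map_pow] at h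
    obtain ⟨d', rfl⟩ := PadicInt.pow_dvd_of_toZModPow_pow_eq hk0 hkp (φ σ) (hφ1 σ) hσ h
    rw [pow_add (π σ), pow_mul (π σ), hπpow, one_pow, mul_one]
  have hdiff : ∀ i j : ℕ, ψ σ ^ i = ψ σ ^ j → π σ ^ i = π σ ^ j := fun i j h =>
    (le_total i j).elim (fun hij => hdiff i j hij h) (fun hij => (hdiff j i hij h.symm).symm)
  have hex : ∀ (N : ℕ) (g : Gal(M/F)), ∃ i : ℕ, PadicInt.toZModPow N (φ g : ℤ_[p]) =
      PadicInt.toZModPow N (φ (σ ^ i) : ℤ_[p]) := by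
    intro N g
    obtain ⟨i, hi⟩ := PadicInt.exists_toZModPow_eq_pow hk0 hkp (φ σ) (hφ1 σ) hσ N (φ g) (hφ1 g)
    exact ⟨i, by rw [hi, map_pow]⟩
  let A : Subgroup (Gal(M/F) ⧸ V) := φ.ker.map π
  -- By compactness the preimage of `A` contains {φ ≡ 1 mod p^j} for some j. Approximating φ(g) by
  -- φ(σ^i) modulo both p^j and p^(e+k) gives `π σ ^ i = 1` and puts `g * (σ ^ i)⁻¹` in that
  -- preimage.
  have hmemA : ∀ g, ψ g = 1 → π g ∈ A := by
    obtain ⟨j, hj⟩ := exists_forall_mem_of_ker_galCyclotomicCharacter_le (p := p) (A.comap π)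
      (Subgroup.isOpen_mono (fun g hg => by
        rw [Subgroup.mem_comap, (hπ g).mpr hg]; exact one_mem _) hV)
      (Subgroup.le_comap_map _ _)
    intro g hg
    obtain ⟨i, hi⟩ := hex (max j (e + k)) g
    have h1 : π σ ^ i = 1 := by
      rw [← pow_zero (π σ)]
      refine hdiff _ _ ?_
      rw [pow_zero, ← hg, ← map_pow, hψ]
      exact (PadicInt.toZModPow_eq_of_le (le_max_right _ _) hi).symm
    have h2 := hj (g * (σ ^ i)⁻¹) (by
      rw [← map_one (PadicInt.toZModPow j), ← PadicInt.dvd_iff_toZModPow_eq]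
      have h3 := (PadicInt.dvd_iff_toZModPow_eq j _ _).mpr
        (PadicInt.toZModPow_eq_of_le (le_max_left _ _) hi)
      have h4 : ((φ (g * (σ ^ i)⁻¹) : ℤ_[p]ˣ) : ℤ_[p]) - 1 =
          ((φ g : ℤ_[p]) - (φ (σ ^ i) : ℤ_[p])) * ((φ (σ ^ i))⁻¹ : ℤ_[p]ˣ) := by
        rw [sub_mul, Units.mul_inv, map_mul, map_inv, Units.val_mul]
      rw [h4]
      exact h3.mul_right _)
    rwa [Subgroup.mem_comap, map_mul, map_inv, map_pow, h1, inv_one, mul_one] at h2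
  have hAconj : ∀ (s : Gal(M/F)), ∀ q ∈ A, ∀ n : ℕ, PadicInt.toZModPow e (n : ℤ_[p]) =
      PadicInt.toZModPow e (φ s : ℤ_[p]) → π s * q * (π s)⁻¹ = q ^ n := by
    rintro s _ ⟨t, ht, rfl⟩ n hn
    rw [← mul_inv_eq_one]
    exact (hπ _).mpr (hrel s t ht n hn)
  have hfin : Finite (Gal(M/F) ⧸ V) := Subgroup.quotient_finite_of_isOpen V hV
  by_contra hτV
  obtain ⟨χ, hχ⟩ := A.exists_monoidHom_units_apply_ne_one (M := M) (n := p ^ e)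
    (x := π τ) (by
      rintro _ ⟨s, hs, rfl⟩ q hq
      have h := hAconj s q hq 1 (by rw [show φ s = 1 from hs]; simp)
      rwa [pow_one, mul_inv_eq_iff_eq_mul] at h)
    (fun q _ => hπpow q) ⟨τ, hτker, rfl⟩ (fun h => hτV ((hπ τ).mp h))
  obtain ⟨a, hamul, hacongr, ha1⟩ := exists_crossedHom_of_generator π ψ A hmemA σ
    (fun g => (hex (e + k) g).imp fun i h => by rw [← map_pow]; exact (hψ _ _).mpr h) hdiff
  have hχpow : ∀ g, ((χ (a g) : Mˣ) : M) ^ p ^ e = 1 := by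
    intro g
    have h : a g ^ p ^ e = 1 := Subtype.ext (hπpow _)
    rw [← Units.val_pow_eq_pow_val, ← map_pow, h, map_one, Units.val_one]
  -- With n ≡ φ(g), the twist by `g` on `A` and the action of `g` on p^e-th roots of unity are both
  -- the n-th power map, so χ turns the crossed homomorphism into a Galois cocycle.
  have hc : ∀ g h, ((χ (a (g * h)) : Mˣ) : M) = χ (a g) * g (χ (a h) : Mˣ) := by
    intro g h
    have : NeZero (p ^ (e + k)) := ⟨pow_ne_zero _ hp.out.ne_zero⟩
    obtain ⟨n, hn⟩ : ∃ n : ℕ, PadicInt.toZModPow (e + k) (n : ℤ_[p]) =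
        PadicInt.toZModPow (e + k) (φ g : ℤ_[p]) :=
      ⟨(PadicInt.toZModPow (e + k) (φ g : ℤ_[p])).val, by
        rw [map_natCast, ZMod.natCast_zmod_val]⟩
    obtain ⟨s, hs, hgh⟩ := hamul g h
    rw [hAconj s _ (a h).2 n (PadicInt.toZModPow_eq_of_le (Nat.le_add_right e k)
      (hn.trans ((hψ _ _).mp hs.symm)))] at hgh
    have hgh' : a (g * h) = a g * a h ^ n := Subtype.ext hgh
    rw [pow_eq_of_toZModPow_natCast_eq (N := n) g (hχpow h)
      (PadicInt.toZModPow_eq_of_le (Nat.le_add_right e k) hn), hgh', map_mul, map_pow,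
      Units.val_mul, Units.val_pow_eq_pow_val]
  -- The value `a g` depends only on `π g` and `ψ g`. Taking `T` with Gal(M/T) inside V and with `ζ`
  -- in `T` controls both.
  obtain ⟨ζ, hζ⟩ := HasEnoughRootsOfUnity.exists_primitiveRoot M (p ^ (e + k))
  have hfd : FiniteDimensional F (IntermediateField.adjoin F {ζ}) :=
    IntermediateField.adjoin.finiteDimensional (Algebra.IsIntegral.isIntegral ζ)
  obtain ⟨T, hTfin, hTgal, hT⟩ := (krullTopology_mem_nhds_one_iff_of_normal F M _).mp
    (inter_mem (hV.mem_nhds (one_mem V)) ((IntermediateField.fixingSubgroup_isOpen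
      (IntermediateField.adjoin F {ζ})).mem_nhds (one_mem _)))
  obtain ⟨y, hy0, hy⟩ := exists_ne_zero_of_mulCocycle (fun g => χ (a g)) hc T (fun g h hgh => by
    have hmem : h⁻¹ * g ∈ T.fixingSubgroup := by
      rw [IntermediateField.mem_fixingSubgroup_iff]
      intro x hx
      rw [AlgEquiv.mul_apply, hgh x hx, ← AlgEquiv.mul_apply, inv_mul_cancel, AlgEquiv.one_apply]
    obtain ⟨h1, h2⟩ := hT hmem
    have h3 : π g = π h := by
      rw [← inv_mul_eq_one, ← map_inv, ← map_mul, hπ, ← inv_mem_iff]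
      simpa using h1
    have h4 : ψ g = ψ h := by
      rw [eq_comm, ← inv_mul_eq_one, ← map_inv, ← map_mul, hψ1]
      exact (galCyclotomicCharacter_toZModPow_eq_one_iff _ hζ).mpr
        ((IntermediateField.mem_fixingSubgroup_iff _ _).mp h2 ζ
          (IntermediateField.mem_adjoin_simple_self F ζ))
    exact congrArg χ (hacongr g h h3 h4))
  -- The cocycle values are p^e-th roots of unity, so `y` is a radical over F and `τ` must fix it.
  have hyF : y ^ p ^ e ∈ (⊥ : IntermediateField F M) := by
    rw [InfiniteGalois.mem_bot_iff_fixed]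
    intro g
    have h2 := congrArg (· ^ p ^ e) (hy g)
    simp only [mul_pow, hχpow, one_mul] at h2
    rw [map_pow, h2]
  have h1 := hy τ
  rw [hτ y e hyF] at h1
  have h2 : χ (a τ) = 1 := Units.ext (mul_right_cancel₀ hy0 (h1.trans (one_mul y).symm))
  have h3 : a τ = ⟨π τ, τ, hτker, rfl⟩ := Subtype.ext (ha1 τ (by
    rw [hψ1, show φ τ = 1 from hτker]; simp))
  exact hχ (h3 ▸ h2)

/-! ### Action of the relations on radicals. -/

theorem zpow_apply_eq_of_apply_eq_mul {F M : Type*} [Field F] [Field M] [Algebra F M]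
    {g : Gal(M/F)} {η y : M} (hη0 : η ≠ 0) (hη : g η = η) (hy : g y = η * y) (n : ℤ) :
    (g ^ n) y = η ^ n * y := by
  have hnat : ∀ m : ℕ, (g ^ m) y = η ^ m * y := by
    intro m
    induction m with
    | zero => simp
    | succ m ih =>
      rw [pow_succ', AlgEquiv.mul_apply, ih, map_mul, map_pow, hη, hy, pow_succ, mul_assoc]
  obtain ⟨m, rfl | rfl⟩ := n.eq_nat_or_neg
  · rw [zpow_natCast, hnat, zpow_natCast]
  · have hfix : ∀ m : ℕ, (g ^ m) η = η := by
      intro m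
      induction m with
      | zero => rfl
      | succ m ih => rw [pow_succ, AlgEquiv.mul_apply, hη, ih]
    rw [zpow_neg, zpow_natCast]
    apply (g ^ m).injective
    rw [← AlgEquiv.mul_apply, mul_inv_cancel, AlgEquiv.one_apply, map_mul, map_zpow₀, hfix, hnat,
      ← mul_assoc, ← zpow_natCast, ← zpow_add₀ hη0, neg_add_cancel, zpow_zero, one_mul]

section

variable {p : ℕ} [hp : Fact p.Prime] {F M : Type*} [Field F] [Field M] [Algebra F M]
  [∀ i, HasEnoughRootsOfUnity M (p ^ i)]

theorem apply_eq_of_mem_ker_galCyclotomicCharacter {τ : Gal(M/F)}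
    (hτ : τ ∈ (galCyclotomicCharacter p F M).ker) {t : M} {n : ℕ} (ht : t ^ p ^ n = 1) :
    τ t = t := by
  rw [pow_eq_of_toZModPow_natCast_eq (N := 1) τ ht
    (by rw [show galCyclotomicCharacter p F M τ = 1 from hτ]; simp), pow_one]

/-- The commutator relation on radicals over `F`. -/
theorem commutator_mul_zpow_apply {σ τ : Gal(M/F)}
    (hτ : τ ∈ (galCyclotomicCharacter p F M).ker) {y : M} {m : ℕ}
    (hy : y ^ p ^ m ∈ (⊥ : IntermediateField F M)) {n : ℤ}
    (hn : PadicInt.toZModPow m (n : ℤ_[p]) =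
      PadicInt.toZModPow m (1 - (galCyclotomicCharacter p F M σ : ℤ_[p]))) :
    (σ * τ * σ⁻¹ * τ⁻¹) ((τ ^ n) y) = y := by
  by_cases hy0 : y = 0
  · simp [hy0]
  obtain ⟨a, ha⟩ := IntermediateField.mem_bot.mp hy
  have hfix : ∀ (g : Gal(M/F)) (z : M) (j : ℕ), z ^ p ^ j = 1 → (g * τ * g⁻¹) z = z := by
    intro g z j hz
    rw [AlgEquiv.mul_apply, AlgEquiv.mul_apply, apply_eq_of_mem_ker_galCyclotomicCharacter hτ
      (n := j) (by rw [← map_pow, hz, map_one]), ← AlgEquiv.mul_apply, mul_inv_cancel,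
      AlgEquiv.one_apply]
  have hquot : ∀ g : Gal(M/F), (g y / y) ^ p ^ m = 1 := by
    intro g
    rw [div_pow, ← map_pow, ← ha, g.commutes, ha, div_self (pow_ne_zero _ hy0)]
  set η := τ y / y with hη
  have hη1 : η ^ p ^ m = 1 := hquot τ
  have hη0 : η ≠ 0 := by
    intro h
    rw [h, zero_pow (pow_ne_zero _ hp.out.ne_zero)] at hη1
    exact zero_ne_one hη1
  have hτy : τ y = η * y := by rw [hη, div_mul_cancel₀ _ hy0]
  have hτη : τ η = η := apply_eq_of_mem_ker_galCyclotomicCharacter hτ hη1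
  -- `σ⁻¹ y` differs from `y` by a root of unity, which `τ` fixes; so `τ` multiplies `σ⁻¹ y` by the
  -- same η.
  have hconj : (σ * τ * σ⁻¹) y = σ η * y := by
    have h1 : σ⁻¹ y = σ⁻¹ y / y * y := by rw [div_mul_cancel₀ _ hy0]
    have h2 : τ (σ⁻¹ y) = η * σ⁻¹ y := by
      rw [h1, map_mul, apply_eq_of_mem_ker_galCyclotomicCharacter hτ (hquot σ⁻¹), hτy]
      ring
    rw [AlgEquiv.mul_apply, AlgEquiv.mul_apply, h2, map_mul, ← AlgEquiv.mul_apply σ σ⁻¹,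
      mul_inv_cancel, AlgEquiv.one_apply]
  have hpm : NeZero (p ^ m) := ⟨pow_ne_zero _ hp.out.ne_zero⟩
  obtain ⟨u, hu⟩ : ∃ u : ℕ, PadicInt.toZModPow m (u : ℤ_[p]) =
      PadicInt.toZModPow m (galCyclotomicCharacter p F M σ : ℤ_[p]) :=
    ⟨(PadicInt.toZModPow m (galCyclotomicCharacter p F M σ : ℤ_[p])).val, by
      rw [map_natCast, ZMod.natCast_zmod_val]⟩
  have hdvd : ((p ^ m : ℕ) : ℤ) ∣ n - 1 + u := by
    rw [← ZMod.intCast_zmod_eq_zero_iff_dvd]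
    rw [map_intCast] at hn
    rw [map_natCast] at hu
    push_cast
    rw [hn, map_sub, map_one, ← hu]
    ring
  have hone : η ^ (n - 1 + u) = 1 := by
    obtain ⟨d, hd⟩ := hdvd
    rw [hd, zpow_mul, zpow_natCast, hη1, one_zpow]
  have hpow1 : (η ^ (n - 1)) ^ p ^ m = 1 := by
    rw [← zpow_natCast, ← zpow_mul, mul_comm, zpow_mul, zpow_natCast, hη1, one_zpow]
  rw [AlgEquiv.mul_apply, ← AlgEquiv.mul_apply τ⁻¹, ← zpow_neg_one τ, ← zpow_add,
    zpow_apply_eq_of_apply_eq_mul hη0 hτη hτy, add_comm, ← sub_eq_add_neg, map_mul,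
    hfix σ _ m hpow1, hconj, pow_eq_of_toZModPow_natCast_eq σ hη1 hu, ← mul_assoc,
    ← zpow_natCast, ← zpow_add₀ hη0, hone, one_mul]

end

/-- CR(F) is generated by radicals, roots of unity being the radicals of 1. The radical 0 is not
among the generators but is fixed anyway. -/
theorem IntermediateField.fixes_iff_forall_mem_bot {p : ℕ} [hp : Fact p.Prime] {F Ω : Type*}
    [Field F] [Field Ω] [Algebra F Ω] {M : IntermediateField F Ω}
    (hle : cyclotomicRadicalExtension p F Ω ≤ M) (g : Gal(M/F)) :
    g ∈ (IntermediateField.restrict hle).fixingSubgroup ↔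
      ∀ (y : M) (m : ℕ), y ^ p ^ m ∈ (⊥ : IntermediateField F M) → g y = y := by
  rw [IntermediateField.mem_fixingSubgroup_iff]
  constructor
  · intro h y m hy
    by_cases hy0 : y = 0
    · rw [hy0, map_zero]
    refine h y ((IntermediateField.mem_restrict hle y).mpr ?_)
    obtain ⟨a, ha⟩ := IntermediateField.mem_bot.mp hy
    have ha0 : a ≠ 0 := by
      rintro rfl
      rw [map_zero] at ha
      exact hy0 (pow_eq_zero_iff (pow_ne_zero _ hp.out.ne_zero) |>.mp ha.symm)
    refine (le_iSup_of_le m (le_iSup_of_le (Units.mk0 a ha0) le_rfl) :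
      IntermediateField.adjoin F _ ≤ cyclotomicRadicalExtension p F Ω)
      (IntermediateField.subset_adjoin F _ (Or.inl ?_))
    exact (congrArg Subtype.val ha).symm
  · intro h y hy
    rw [IntermediateField.mem_restrict] at hy
    have hCR : cyclotomicRadicalExtension p F Ω ≤ IntermediateField.lift
        (IntermediateField.fixedField (Subgroup.zpowers g)) := by
      refine iSup_le fun m => iSup_le fun a => IntermediateField.adjoin_le_iff.mpr fun x hx => ?_
      have hxM : x ∈ M := hle ((le_iSup_of_le m (le_iSup_of_le a le_rfl) :
        IntermediateField.adjoin F _ ≤ cyclotomicRadicalExtension p F Ω)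
        (IntermediateField.subset_adjoin F _ hx))
      have hgx : g ⟨x, hxM⟩ = ⟨x, hxM⟩ := by
        refine h _ m (IntermediateField.mem_bot.mpr ?_)
        rcases hx with hx | hx
        · exact ⟨a, Subtype.ext (Eq.symm hx)⟩
        · exact ⟨1, Subtype.ext (by simpa using Eq.symm hx)⟩
      refine ⟨⟨x, hxM⟩, fun z => ?_, rfl⟩
      have : Subgroup.zpowers g ≤ MulAction.stabilizer Gal(M/F) (⟨x, hxM⟩ : M) :=
        Subgroup.zpowers_le.mpr hgx
      exact this z.2
    obtain ⟨z, hz, hzy⟩ := hCR hy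
    rw [show y = z from Subtype.ext hzy.symm]
    exact hz ⟨g, Subgroup.mem_zpowers g⟩

/-! ### The restriction map G_L(p) → G_K(p). -/

section Restriction

variable {p : ℕ} [Fact p.Prime] {K Ω : Type*} [Field K] [Field Ω] [Algebra K Ω]

theorem continuous_proPRestrict [Algebra.IsSeparable K Ω] (L : IntermediateField K Ω) :
    Continuous (proPRestrict p L) := by
  refine continuous_of_continuousAt_one _ ?_
  rw [ContinuousAt, map_one]
  intro s hs
  obtain ⟨E, hE, hEs⟩ := (krullTopology_mem_nhds_one_iff K _ _).mp hs
  obtain ⟨S, hS⟩ := IntermediateField.fg_of_fg_toSubalgebra E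
    (Subalgebra.fg_of_fg_toSubmodule (Module.Finite.iff_fg.mp hE))
  -- Generators of `E` viewed in L(p) span a finite extension of L, and automorphisms fixing it
  -- restrict to automorphisms fixing `E`.
  let E' : IntermediateField L (maximalPExtension p L Ω) :=
    IntermediateField.adjoin L (maximalPExtensionInclusion p L '' S)
  have hE' : FiniteDimensional L E' := by
    have := (S.finite_toSet.image (maximalPExtensionInclusion p L)).to_subtype
    exact IntermediateField.finiteDimensional_adjoin fun x _ => Algebra.IsIntegral.isIntegral x
  refine mem_map.mpr ((krullTopology_mem_nhds_one_iff L _ _).mpr ⟨E', hE', fun g hg => hEs ?_⟩)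
  have hle : E ≤ IntermediateField.fixedField (Subgroup.zpowers (proPRestrict p L g)) := by
    rw [← hS]
    refine IntermediateField.adjoin_le_iff.mpr fun y hy z => ?_
    have hgy : proPRestrict p L g y = y := by
      apply (maximalPExtensionInclusion p L).injective
      rw [proPRestrict_apply]
      exact (IntermediateField.mem_fixingSubgroup_iff _ _).mp hg _
        (IntermediateField.subset_adjoin L _ ⟨y, hy, rfl⟩)
    have : Subgroup.zpowers (proPRestrict p L g) ≤
        MulAction.stabilizer (proPGaloisGroup p K Ω) y := Subgroup.zpowers_le.mpr hgy
    exact this z.2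
  rw [SetLike.mem_coe, IntermediateField.mem_fixingSubgroup_iff]
  exact fun y hy => hle hy ⟨_, Subgroup.mem_zpowers _⟩

variable [IsGalois K Ω] {L : IntermediateField K Ω}

/-- Surjectivity is p-closedness of K(p): the fields K(p) and L(p) coincide inside Ω. -/
theorem maximalPExtensionInclusion_bijective (hL : L ≤ maximalPExtension p K Ω) :
    Function.Bijective (maximalPExtensionInclusion p L) :=
  ⟨(maximalPExtensionInclusion p L).injective, fun x =>
    ⟨⟨x, maximalPExtension_subset_of_le p hL x.2⟩, rfl⟩⟩

theorem proPRestrict_injective (hL : L ≤ maximalPExtension p K Ω) :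
    Function.Injective (proPRestrict p L) := by
  intro g h hgh
  ext x
  obtain ⟨y, rfl⟩ := (maximalPExtensionInclusion_bijective hL).2 x
  rw [← proPRestrict_apply, ← proPRestrict_apply, hgh]

theorem range_proPRestrict (hL : L ≤ maximalPExtension p K Ω) :
    (proPRestrict p L).range = (IntermediateField.restrict hL).fixingSubgroup := by
  ext h
  rw [IntermediateField.mem_fixingSubgroup_iff]
  constructor
  · rintro ⟨g, rfl⟩ x hx
    rw [IntermediateField.mem_restrict] at hx
    apply (maximalPExtensionInclusion p L).injective
    rw [proPRestrict_apply]
    exact g.commutes ⟨x, hx⟩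
  · intro hh
    let e := RingEquiv.ofBijective _ (maximalPExtensionInclusion_bijective (p := p) hL)
    -- Transport `h` along K(p) = L(p); the result is L-linear because `h` fixes L.
    let g : proPGaloisGroup p L Ω := AlgEquiv.ofRingEquiv
      (f := (e.symm.trans h.toRingEquiv).trans e) fun a => by
        have ha : e.symm (algebraMap L _ a) = ⟨a, hL a.2⟩ := by
          rw [RingEquiv.symm_apply_eq]
          rfl
        change e (h (e.symm (algebraMap L _ a))) = _
        rw [ha, hh _ ((IntermediateField.mem_restrict hL _).mpr a.2)]
        rfl
    refine ⟨g, ?_⟩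
    ext x
    refine congrArg Subtype.val ((maximalPExtensionInclusion p L).injective ?_)
    rw [proPRestrict_apply]
    change e (h (e.symm (e x))) = _
    rw [RingEquiv.symm_apply_apply]
    rfl

/-- A continuous injection from a compact space to a Hausdorff space is a closed embedding. -/
theorem isClosedEmbedding_proPRestrict (hL : L ≤ maximalPExtension p K Ω) :
    Topology.IsClosedEmbedding (proPRestrict p L) := by
  have : IsGalois L (maximalPExtension p L Ω) := ⟨⟩
  exact (continuous_proPRestrict L).isClosedEmbedding (proPRestrict_injective hL)

end Restriction

/-! ### Open normal subgroups have p-power index. -/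

theorem tendsto_pow_prime_pow_nhds_one (p : ℕ) [hp : Fact p.Prime] (K Ω : Type*) [Field K]
    [Field Ω] [Algebra K Ω] [Algebra.IsSeparable K Ω] (g : proPGaloisGroup p K Ω) :
    Tendsto (fun n : ℕ => g ^ p ^ n) atTop (𝓝 1) := by
  have : IsGalois K (maximalPExtension p K Ω) := ⟨⟩
  have hlim := tendsto_padicPow p K Ω g 0
  have hpure : pure (0 : ℤ) ≤ comap (Int.cast : ℤ → ℤ_[p]) (𝓝 0) := by
    rw [← map_le_iff_le_comap, map_pure, Int.cast_zero]
    exact pure_le_nhds 0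
  have h1 : padicPow g (0 : ℤ_[p]) = 1 := by
    refine tendsto_nhds_unique (hlim.mono_left hpure) ?_
    have := tendsto_pure_nhds (fun n : ℤ => g ^ n) 0
    rwa [zpow_zero] at this
  rw [h1] at hlim
  have h2 : Tendsto (fun n : ℕ => ((p ^ n : ℕ) : ℤ)) atTop (comap (Int.cast : ℤ → ℤ_[p]) (𝓝 0)) := by
    rw [tendsto_comap_iff]
    refine (tendsto_pow_atTop_nhds_zero_of_norm_lt_one (x := (p : ℤ_[p])) ?_).congr fun n => ?_
    · rw [PadicInt.norm_p]
      exact inv_lt_one_of_one_lt₀ (by exact_mod_cast hp.out.one_lt)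
    · simp
  refine (hlim.comp h2).congr fun n => ?_
  simp only [Function.comp_apply, zpow_natCast]

theorem exists_pow_prime_pow_mem (p : ℕ) [hp : Fact p.Prime] (K Ω : Type*) [Field K]
    [Field Ω] [Algebra K Ω] [Algebra.IsSeparable K Ω] (V : Subgroup (proPGaloisGroup p K Ω))
    [V.Normal] (hV : IsOpen (V : Set (proPGaloisGroup p K Ω))) :
    ∃ e : ℕ, ∀ g : proPGaloisGroup p K Ω, g ^ p ^ e ∈ V := by
  have : IsGalois K (maximalPExtension p K Ω) := ⟨⟩
  have hfin : Finite (proPGaloisGroup p K Ω ⧸ V) := Subgroup.quotient_finite_of_isOpen V hV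
  have hP : IsPGroup p (proPGaloisGroup p K Ω ⧸ V) := by
    intro q
    obtain ⟨g, rfl⟩ := QuotientGroup.mk_surjective q
    obtain ⟨n, hn⟩ := ((tendsto_pow_prime_pow_nhds_one p K Ω g).eventually
      (hV.mem_nhds V.one_mem)).exists
    exact ⟨n, (QuotientGroup.eq_one_iff _).mpr hn⟩
  obtain ⟨e, he⟩ := IsPGroup.iff_card.mp hP
  refine ⟨e, fun g => (QuotientGroup.eq_one_iff _).mp ?_⟩
  rw [QuotientGroup.mk_pow, ← he, pow_card_eq_one']

/-! ### The closed subgroup generated by the relations. -/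

section Relations

variable (p : ℕ) [hp : Fact p.Prime] (F Ω : Type*) [Field F] [Field Ω] [Algebra F Ω]

/-- The elements `[σ, τ] τ ^ (1 - φ(σ))` with `τ ∈ ker φ`. -/
def cyclotomicRelations : Set (proPGaloisGroup p F Ω) :=
  {g | ∃ σ τ : proPGaloisGroup p F Ω, τ ∈ (proPCyclotomicCharacter p F Ω).ker ∧
    g = (σ * τ * σ⁻¹ * τ⁻¹) * padicPow τ (1 - (proPCyclotomicCharacter p F Ω σ : ℤ_[p]))}

variable [Algebra.IsSeparable F Ω]

/-- Conjugating the relation of (σ, τ) gives the relation of the conjugated pair, since φ takes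
values in an abelian group. Hence the relations generate a normal subgroup. -/
theorem conj_mem_cyclotomicRelations {g : proPGaloisGroup p F Ω}
    (hg : g ∈ cyclotomicRelations p F Ω) (h : proPGaloisGroup p F Ω) :
    h * g * h⁻¹ ∈ cyclotomicRelations p F Ω := by
  obtain ⟨σ, τ, hτ, rfl⟩ := hg
  refine ⟨h * σ * h⁻¹, h * τ * h⁻¹, (MonoidHom.normal_ker _).conj_mem τ hτ h, ?_⟩
  have hφ : proPCyclotomicCharacter p F Ω (h * σ * h⁻¹) = proPCyclotomicCharacter p F Ω σ := by
    rw [map_mul, map_mul, map_inv, mul_right_comm, mul_inv_cancel, one_mul]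
  rw [hφ, ← conj_padicPow]
  group

theorem closure_cyclotomicRelations_normal :
    (Subgroup.closure (cyclotomicRelations p F Ω)).Normal := by
  have : Subgroup.normalClosure (cyclotomicRelations p F Ω) =
      Subgroup.closure (cyclotomicRelations p F Ω) := by
    refine congrArg Subgroup.closure (Set.Subset.antisymm ?_ Group.subset_conjugatesOfSet)
    intro g hg
    obtain ⟨a, ha, hag⟩ := Group.mem_conjugatesOfSet_iff.mp hg
    obtain ⟨c, rfl⟩ := isConj_iff.mp hag
    exact conj_mem_cyclotomicRelations p F Ω ha c
  rw [← this]
  infer_instance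

variable {p F Ω} [∀ i, HasEnoughRootsOfUnity (maximalPExtension p F Ω) (p ^ i)]

theorem apply_eq_of_mem_cyclotomicRelations {g : proPGaloisGroup p F Ω}
    (hg : g ∈ cyclotomicRelations p F Ω) (y : maximalPExtension p F Ω) (m : ℕ)
    (hy : y ^ p ^ m ∈ (⊥ : IntermediateField F (maximalPExtension p F Ω))) : g y = y := by
  obtain ⟨σ, τ, hτ, rfl⟩ := hg
  set P := padicPow τ (1 - (proPCyclotomicCharacter p F Ω σ : ℤ_[p])) with hP
  have hfd : FiniteDimensional F (IntermediateField.adjoin F {y}) :=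
    IntermediateField.adjoin.finiteDimensional (Algebra.IsIntegral.isIntegral y)
  have hU : (fun x => P⁻¹ * x) ⁻¹' ((IntermediateField.adjoin F {y}).fixingSubgroup :
      Set (proPGaloisGroup p F Ω)) ∈ 𝓝 P := by
    refine (continuous_const_mul P⁻¹).continuousAt.preimage_mem_nhds ?_
    rw [inv_mul_cancel]
    exact (IntermediateField.fixingSubgroup_isOpen _).mem_nhds (one_mem _)
  -- An integral power of `τ` acts on `y` as the p-adic power does, with exponent correct modulo
  -- p^m, which is all that matters for p^m-th roots of unity.
  obtain ⟨n, hn, hnU⟩ := exists_zpow_eq_padicPow_mod p F Ω τ _ m hU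
  have h1 : (P⁻¹ * τ ^ n) y = y := (IntermediateField.mem_fixingSubgroup_iff _ _).mp hnU y
    (IntermediateField.mem_adjoin_simple_self F y)
  have h2 : P y = (τ ^ n) y := by
    conv_lhs => rw [← h1]
    rw [← AlgEquiv.mul_apply, mul_inv_cancel_left]
  rw [AlgEquiv.mul_apply, h2]
  exact commutator_mul_zpow_apply hτ hy hn

/-- Since p^e-th powers lie in V, exponents count only modulo p^e in G/V, and the relations say s t
s⁻¹ = t^n there for n ≡ φ(s) mod p^e. This is the conjugation hypothesis of the cocycle argument. -/
theorem mem_of_cyclotomicRelations_subset {k : ℕ} (hk0 : k ≠ 0) (hkp : k + 2 ≤ p * k)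
    (hk : ∃ ζ : F, IsPrimitiveRoot ζ (p ^ k)) (hk' : ¬ ∃ ζ : F, IsPrimitiveRoot ζ (p ^ (k + 1)))
    (V : Subgroup (proPGaloisGroup p F Ω)) [V.Normal]
    (hV : IsOpen (V : Set (proPGaloisGroup p F Ω))) (hR : cyclotomicRelations p F Ω ⊆ V)
    {τ : proPGaloisGroup p F Ω}
    (hτ : ∀ (y : maximalPExtension p F Ω) (m : ℕ),
      y ^ p ^ m ∈ (⊥ : IntermediateField F (maximalPExtension p F Ω)) → τ y = y) : τ ∈ V := by
  have : IsGalois F (maximalPExtension p F Ω) := ⟨⟩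
  obtain ⟨e, he⟩ := exists_pow_prime_pow_mem p F Ω V hV
  refine mem_of_conj_eq_pow_galCyclotomicCharacter hk0 hkp hk hk' V hV he ?_ hτ
  intro s t ht n hn
  have h1 := hR ⟨s, t, ht, rfl⟩
  set P := padicPow t (1 - (proPCyclotomicCharacter p F Ω s : ℤ_[p])) with hP
  have hU : (fun x => P⁻¹ * x) ⁻¹' (V : Set (proPGaloisGroup p F Ω)) ∈ 𝓝 P := by
    refine (continuous_const_mul P⁻¹).continuousAt.preimage_mem_nhds ?_
    rw [inv_mul_cancel]
    exact hV.mem_nhds (one_mem _)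
  obtain ⟨n', hn', hnU⟩ := exists_zpow_eq_padicPow_mod p F Ω t _ e hU
  have hdvd : ((p ^ e : ℕ) : ℤ) ∣ n' + n - 1 := by
    rw [← ZMod.intCast_zmod_eq_zero_iff_dvd]
    rw [map_intCast, map_sub, map_one] at hn'
    rw [map_natCast] at hn
    push_cast
    rw [hn', hn]
    exact sub_eq_zero.mpr (sub_add_cancel _ _)
  obtain ⟨d, hd⟩ := hdvd
  have h2 : s * t * s⁻¹ * t⁻¹ * P * (P⁻¹ * t ^ n') * ((t ^ p ^ e) ^ d)⁻¹ ∈ V :=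
    V.mul_mem (V.mul_mem h1 hnU) (V.inv_mem (V.zpow_mem (he t) d))
  have h3 : n' = 1 + (((p ^ e : ℕ) : ℤ) * d + -(n : ℤ)) := by linarith
  convert h2 using 1
  rw [← zpow_natCast t (p ^ e), ← zpow_mul, h3, zpow_add, zpow_one, add_comm, zpow_add, zpow_neg,
    zpow_natCast]
  group

theorem topologicalClosure_cyclotomicRelations
    (hle : cyclotomicRadicalExtension p F Ω ≤ maximalPExtension p F Ω)
    {k : ℕ} (hk0 : k ≠ 0) (hkp : k + 2 ≤ p * k)
    (hk : ∃ ζ : F, IsPrimitiveRoot ζ (p ^ k))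
    (hk' : ¬ ∃ ζ : F, IsPrimitiveRoot ζ (p ^ (k + 1))) :
    (IntermediateField.restrict hle).fixingSubgroup =
      (Subgroup.closure (cyclotomicRelations p F Ω)).topologicalClosure := by
  have : IsGalois F (maximalPExtension p F Ω) := ⟨⟩
  refine le_antisymm (fun τ hτ => ?_) ?_
  · rw [IntermediateField.fixes_iff_forall_mem_bot] at hτ
    have := closure_cyclotomicRelations_normal p F Ω
    let H : ClosedSubgroup (proPGaloisGroup p F Ω) :=
      ⟨(Subgroup.closure (cyclotomicRelations p F Ω)).topologicalClosure,
        Subgroup.isClosed_topologicalClosure _⟩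
    have hHn : H.toSubgroup.Normal := Subgroup.is_normal_topologicalClosure _
    change τ ∈ H.toSubgroup
    -- As H is closed, it suffices that `τ` fixes each `x` fixed by H. With E the Galois closure of
    -- `x`, the subgroup H · Gal(M/E) is open and normal, contains the relations, and still fixes
    -- `x`.
    rw [← InfiniteGalois.fixingSubgroup_fixedField H, IntermediateField.mem_fixingSubgroup_iff]
    intro x hx
    let E := FiniteGaloisIntermediateField.adjoin F {x}
    have hEn : E.fixingSubgroup.Normal := inferInstance
    have hV : IsOpen ((H.toSubgroup ⊔ E.fixingSubgroup : Subgroup _) :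
        Set (proPGaloisGroup p F Ω)) :=
      Subgroup.isOpen_mono le_sup_right E.toIntermediateField.fixingSubgroup_isOpen
    have hR : cyclotomicRelations p F Ω ⊆ (H.toSubgroup ⊔ E.fixingSubgroup : Subgroup _) :=
      fun g hg => (le_sup_left : H.toSubgroup ≤ H.toSubgroup ⊔ E.fixingSubgroup)
        (Subgroup.le_topologicalClosure _ (Subgroup.subset_closure hg))
    have hτV := mem_of_cyclotomicRelations_subset hk0 hkp hk hk' _ hV hR hτ
    have hstab : H.toSubgroup ⊔ E.fixingSubgroup ≤
        MulAction.stabilizer (proPGaloisGroup p F Ω) x := by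
      refine sup_le (fun g hg => hx ⟨g, hg⟩) (fun g hg => ?_)
      exact (IntermediateField.mem_fixingSubgroup_iff _ _).mp hg x
        (FiniteGaloisIntermediateField.subset_adjoin F {x} rfl)
    exact hstab hτV
  · refine Subgroup.topologicalClosure_minimal _ ((Subgroup.closure_le _).mpr fun g hg => ?_)
      (InfiniteGalois.fixingSubgroup_isClosed _)
    rw [SetLike.mem_coe, IntermediateField.fixes_iff_forall_mem_bot]
    exact apply_eq_of_mem_cyclotomicRelations hg

end Relations

theorem mainTheorem8 (p : ℕ) [Fact p.Prime] (F Fsep : Type*) [Field F] [Field Fsep]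
    [Algebra F Fsep] [IsSepClosure F Fsep]
    (hodd : p ≠ 2 → ∃ ζ : F, IsPrimitiveRoot ζ p)
    (htwo : p = 2 → ∃ ζ : F, IsPrimitiveRoot ζ 4)
    (k : ℕ) (hk : ∃ ζ : F, IsPrimitiveRoot ζ (p ^ k))
    (hk' : ¬ ∃ ζ : F, IsPrimitiveRoot ζ (p ^ (k + 1))) :
    Topology.IsClosedEmbedding (proPRestrict p (cyclotomicRadicalExtension p F Fsep)) ∧
    (proPRestrict p (cyclotomicRadicalExtension p F Fsep)).range =
      (Subgroup.closure {g : proPGaloisGroup p F Fsep |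
        ∃ σ τ : proPGaloisGroup p F Fsep, τ ∈ (proPCyclotomicCharacter p F Fsep).ker ∧
          g = (σ * τ * σ⁻¹ * τ⁻¹) * padicPow τ (1 - (proPCyclotomicCharacter p F Fsep σ : ℤ_[p]))
        }).topologicalClosure := by
  have hprim : ∃ ζ : F, IsPrimitiveRoot ζ p := by
    by_cases h2 : p = 2
    · obtain ⟨ζ, hζ⟩ := htwo h2
      subst h2
      exact ⟨ζ ^ 2, hζ.pow (by norm_num) (by norm_num)⟩
    · exact hodd h2
  have hk0 : k ≠ 0 := by
    rintro rfl
    exact hk' (by simpa using hprim)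
  -- For p = 2 the fourth root of unity rules out k = 1; for odd p, k ≥ 1 is enough.
  have hkp : k + 2 ≤ p * k := by
    by_cases h2 : p = 2
    · have hk1 : k ≠ 1 := by
        rintro rfl
        subst h2
        exact hk' (by simpa using htwo rfl)
      subst h2
      omega
    · have h3 : 3 ≤ p := by
        have := (Fact.out : p.Prime).two_le
        omega
      nlinarith [Nat.mul_le_mul_right k h3, Nat.pos_of_ne_zero hk0]
  obtain ⟨ζ, hζ⟩ := hprim
  have hroots := hasEnoughRootsOfUnity_maximalPExtension (Ω := Fsep) hζ
  have hle := cyclotomicRadicalExtension_le (Ω := Fsep) hζ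
  exact ⟨isClosedEmbedding_proPRestrict hle,
    (range_proPRestrict hle).trans (topologicalClosure_cyclotomicRelations hle hk0 hkp hk hk')⟩
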